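/- Consider a transmitter $S$ that sends a message to a destination through two relays. In each channel use the relays receive $Y_1=X+J+N_1$ and $Y_2=-X+J+N_2$, respectively, where $X$ is the channel input and $J,N_1,N_2$ are independent memoryless zero-mean Gaussian processes of variances $P_J,1,1$. Relay $i$ observes only $Y_i$ and forwards $C_i$ bits per channel use over a noiseless link to the destination ("Case C"). A code of length $n$ and rate $R$ has $\lfloor 2^{nR}\rfloor$ equiprobable messages, average power $\frac1n\sum_{k=1}^n \mathrm E[X_k^2]\le P_X$, deterministic encoder and decoder, and (measurable) relay maps into sets of $\lfloor 2^{nC_1}\rfloor$ and $\lfloor 2^{nC_2}\rfloor$ elements; $R$ is achievable if for every $\varepsilon>0$ and all sufficiently large $n$ there is such a code with average error probability at most $\varepsilon$. The cut-set bound is $$R_{\rm cut}=\sup_{P_X\text{-admissible }X}\min\{C_1+C_2,\;C_1+I(X;Y_2),\;C_2+I(X;Y_1),\;I(X;Y_1,Y_2)\},$$ the supremum being over all input laws with $\mathrm E[X^2]\le P_X$ and $I$ being measured in bits, and the modulo bound is $$R_{\rm mod}=\tfrac12\Big(C_1+C_2+\tfrac12\log_2\big(1+\tfrac{P_X}{P_J}\big)\Big)+\tfrac14\log_2(8\pi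 e).$$ **Corollary (the cut-set upper bound is strictly loose for Case C).** Take $P_J=\sqrt{P_X}$ and $C_1=C_2=\frac14\log_2 P_X$. Then: 1. for every $P_X>1$, $R_{\rm cut}$ is finite, and $\lim_{P_X\to\infty} R_{\rm cut}/\log_2 P_X=\frac12$; 2. for every $P_X>1$, every achievable rate $R$ satisfies $R\le R_{\rm mod}$, and $\lim_{P_X\to\infty} R_{\rm mod}/\log_2 P_X=\frac38$; 3. consequently the cut-set bound is strictly loose: there is $\varepsilon>0$ such that for all sufficiently large $P_X$ one has $R_{\rm mod}+\varepsilon\log_2P_X\le R_{\rm cut}$ and every achievable rate $R$ satisfies $R+\varepsilon\log_2 P_X\le R_{\rm cut}$. -/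

import Mathlib

open MeasureTheory ProbabilityTheory Filter Topology
open scoped NNReal ENNReal

noncomputable section

namespace RelayChannel

/-- One transmitter, two relays: `Y₁ = a X + J + N₁`, `Y₂ = b X + J + N₂`, with input power `PX`,
interference power `PJ`, noise powers `PN1`, `PN2`, and lossless relay-to-destination links of
`C1`, `C2` bits per channel use. -/
structure Network where
  a : ℝ
  b : ℝ
  PX : ℝ≥0
  PJ : ℝ≥0
  PN1 : ℝ≥0
  PN2 : ℝ≥0
  C1 : ℝ
  C2 : ℝ

/-- Relaying two interfered signals in anti-phase, with unit noise powers. -/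
def caseC (PX PJ : ℝ≥0) (C1 C2 : ℝ) : Network where
  a := 1
  b := -1
  PX := PX
  PJ := PJ
  PN1 := 1
  PN2 := 1
  C1 := C1
  C2 := C2

/-- The index set `I_r = {1, …, 2^r}` has `⌊2^r⌋` elements. -/
def numIndices (r : ℝ) : ℕ := ⌊(2 : ℝ) ^ r⌋₊

namespace Network

variable (N : Network)

/-- Joint law of `(J, N₁, N₂)` in one channel use: independent centred Gaussians. -/
def noise : Measure (ℝ × ℝ × ℝ) :=
  (gaussianReal 0 N.PJ).prod ((gaussianReal 0 N.PN1).prod (gaussianReal 0 N.PN2))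

/-- First output, from the input `x` and `z = (j, n₁, n₂)`. -/
def out1 (x : ℝ) (z : ℝ × ℝ × ℝ) : ℝ := N.a * x + z.1 + z.2.1

/-- Second output, from the input `x` and `z = (j, n₁, n₂)`. -/
def out2 (x : ℝ) (z : ℝ × ℝ × ℝ) : ℝ := N.b * x + z.1 + z.2.2

/-- Law of the memoryless noise over `n` channel uses. -/
def noiseN (n : ℕ) : Measure (Fin n → ℝ × ℝ × ℝ) := Measure.pi fun _ => N.noise

/-- A block code of length `n` and rate `R`: encoder, two relay maps, decoder. The average power
constraint is over the uniformly distributed message and the `n` channel uses. -/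
structure Code (n : ℕ) (R : ℝ) where
  enc : Fin (numIndices (n * R)) → Fin n → ℝ
  relay1 : (Fin n → ℝ) → Fin (numIndices (n * N.C1))
  relay2 : (Fin n → ℝ) → Fin (numIndices (n * N.C2))
  dec : Fin (numIndices (n * N.C1)) × Fin (numIndices (n * N.C2)) → Fin (numIndices (n * R))
  measurable_relay1 : Measurable relay1
  measurable_relay2 : Measurable relay2
  power : (∑ w, ∑ k, enc w k ^ 2) / (numIndices (n * R) : ℝ) ≤ n * N.PX

variable {N} in
/-- The average probability `Pr{Ŵ ≠ W}`, for a uniformly distributed message `W`. -/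
def Code.errorProb {n : ℕ} {R : ℝ} (c : N.Code n R) : ℝ :=
  (∑ w, (N.noiseN n).real {z |
      c.dec (c.relay1 fun k => N.out1 (c.enc w k) (z k),
        c.relay2 fun k => N.out2 (c.enc w k) (z k)) ≠ w}) / (numIndices (n * R) : ℝ)

/-- `R` is achievable: the average error probability can be made arbitrarily small for all
sufficiently large block lengths. -/
def Achievable (R : ℝ) : Prop :=
  ∀ ε : ℝ, 0 < ε → ∃ n₀ : ℕ, ∀ n ≥ n₀, ∃ c : N.Code n R, c.errorProb ≤ ε

end Network

/-- Mutual information, in bits, of the two components of a pair with joint law `ρ`. -/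
def mutualInfo {α β : Type*} [MeasurableSpace α] [MeasurableSpace β] (ρ : Measure (α × β)) :
    ℝ≥0∞ :=
  InformationTheory.klDiv ρ (ρ.fst.prod ρ.snd) / ENNReal.ofReal (Real.log 2)

namespace Network

variable (N : Network)

/-- `I(X; Y₁)` for an input `X` with law `μ`. -/
def info1 (μ : Measure ℝ) : ℝ≥0∞ :=
  mutualInfo ((μ.prod N.noise).map fun p => (p.1, N.out1 p.1 p.2))

/-- `I(X; Y₂)` for an input `X` with law `μ`. -/
def info2 (μ : Measure ℝ) : ℝ≥0∞ :=
  mutualInfo ((μ.prod N.noise).map fun p => (p.1, N.out2 p.1 p.2))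

/-- `I(X; Y₁, Y₂)` for an input `X` with law `μ`. -/
def info12 (μ : Measure ℝ) : ℝ≥0∞ :=
  mutualInfo ((μ.prod N.noise).map fun p => (p.1, (N.out1 p.1 p.2, N.out2 p.1 p.2)))

/-- The cut-set bound: the supremum, over all input laws of power at most `PX`, of
`min {C₁ + C₂, C₁ + I(X; Y₂), C₂ + I(X; Y₁), I(X; Y₁, Y₂)}`. -/
def cutSetBound : ℝ≥0∞ :=
  ⨆ (μ : Measure ℝ) (_ : IsProbabilityMeasure μ)
    (_ : ∫⁻ x, ENNReal.ofReal (x ^ 2) ∂μ ≤ N.PX),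
    min (min (ENNReal.ofReal N.C1 + ENNReal.ofReal N.C2) (ENNReal.ofReal N.C1 + N.info2 μ))
      (min (ENNReal.ofReal N.C2 + N.info1 μ) (N.info12 μ))

/-- The modulo bound
`½ (C₁ + C₂ + ½ log₂ (1 + PX / PJ)) + ¼ log₂ (8 π e)`. -/
def moduloBound : ℝ :=
  (N.C1 + N.C2 + Real.logb 2 (1 + (N.PX : ℝ) / N.PJ) / 2) / 2
    + Real.logb 2 (8 * Real.pi * Real.exp 1) / 4

end Network

/-- The network of Case C with `PJ = √P` and `C₁ = C₂ = ¼ log₂ P`. -/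
def looseExample (P : ℝ≥0) : Network :=
  caseC P (NNReal.sqrt P) (Real.logb 2 P / 4) (Real.logb 2 P / 4)

end RelayChannel

end

/-! The cut-set side is elementary. The cut `C₁ + C₂` alone caps the bound at `½ log₂ P`. An input
uniform on `[-√P, √P]` nearly attains this: `(Y₁ - Y₂) / 2` cancels the interference and yields
about `½ log₂ P` bits, while one output, with noise variance `√P + 1`, still yields about `¼ log₂
P`, to which the other link adds `¼ log₂ P`. The mutual informations are bounded below by testing
the divergence on the event that the output locates the input (`mul_measure_le_klDiv_add_one`,
`ofReal_le_mutualInfo`).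

The converse introduces a genie `T`, the input rounded coordinatewise to the grid of step `√PJ`.
With `A`, `B` the relay messages, submodularity of entropy and Fano's inequality give, up to the
Fano term, `2 H(W) ≤ H(A, B) + H(T) + I(A; W | T) + I(B; W | T)` (`two_mul_entropy_le`); conditional
independence of `A` and `B` given `W` is not needed. Once `T` is known, the input is known to within
`√PJ / 2`, below the noise level of each relay, so each conditional information is at most `n / 8`
nats. The entropy of `T` is at most its cross entropy with a discrete Gaussian, `n (½ log (1 + PX /
PJ) + const)`. The link capacities are thus charged once against twice the rate, which gives `⅜ log₂
P` instead of `½ log₂ P`.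

`log_card_le_of_genie` is the finite form of this argument, `log_le_of_errorProb_le` applies it to a
block code, and `Network.Achievable.le_moduloBound` lets the block length grow. -/

noncomputable section

namespace RelayChannel

/-! ### Shannon entropy on finite weighted sample spaces -/

section Entropy

open Classical in
/-- The law of `h` under the weights `p`, on a finite sample space. -/
def law {Ω β : Type*} [Fintype Ω] (p : Ω → ℝ) (h : Ω → β) (y : β) : ℝ :=
  ∑ ω, if h ω = y then p ω else 0

/-- Shannon entropy, in nats, of `h` under the weights `p`. -/
def entropy {Ω β : Type*} [Fintype Ω] (p : Ω → ℝ) (h : Ω → β) : ℝ :=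
  -∑ ω, p ω * Real.log (law p h (h ω))

variable {Ω α β γ : Type*} [Fintype Ω] {p : Ω → ℝ}

lemma law_nonneg (hp : ∀ ω, 0 ≤ p ω) (h : Ω → β) (y : β) : 0 ≤ law p h y :=
  Finset.sum_nonneg fun ω _ => by split_ifs <;> simp [hp ω]

lemma le_law (hp : ∀ ω, 0 ≤ p ω) (h : Ω → β) (ω : Ω) : p ω ≤ law p h (h ω) := by
  classical
  have := Finset.single_le_sum (f := fun ω' => if h ω' = h ω then p ω' else 0)
    (fun ω' _ => by split_ifs <;> simp [hp ω']) (Finset.mem_univ ω)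
  simp only [if_true] at this
  unfold law
  convert this

lemma law_mono (hp : ∀ ω, 0 ≤ p ω) (h : Ω → β) (k : Ω → γ) {ω : Ω}
    (hk : ∀ ω', k ω' = k ω → h ω' = h ω) : law p k (k ω) ≤ law p h (h ω) := by
  refine Finset.sum_le_sum fun ω' _ => ?_
  by_cases h1 : k ω' = k ω
  · simp [h1, hk ω' h1]
  · simp only [h1, if_false]
    split_ifs <;> simp [hp ω']

lemma sum_law_mul [Fintype β] (h : Ω → β) (G : β → ℝ) :
    ∑ y, law p h y * G y = ∑ ω, p ω * G (h ω) := by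
  classical
  simp only [law, Finset.sum_mul]
  rw [Finset.sum_comm]
  refine Finset.sum_congr rfl fun ω _ => ?_
  rw [Finset.sum_eq_single (h ω)] <;> simp +contextual [eq_comm]

lemma sum_law_pair [Fintype α] (g : Ω → α) (h : Ω → β) (y : β) :
    ∑ x, law p (fun ω => (g ω, h ω)) (x, y) = law p h y := by
  classical
  simp only [law]
  rw [Finset.sum_comm]
  refine Finset.sum_congr rfl fun ω _ => ?_
  rw [Finset.sum_eq_single (g ω)] <;> simp +contextual [eq_comm]

lemma entropy_mono (hp : ∀ ω, 0 ≤ p ω) (h : Ω → β) (k : Ω → γ)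
    (hk : ∀ ω ω', k ω' = k ω → h ω' = h ω) : entropy p h ≤ entropy p k := by
  refine neg_le_neg (Finset.sum_le_sum fun ω _ => ?_)
  rcases (hp ω).eq_or_lt with h0 | h0
  · simp [← h0]
  · exact mul_le_mul_of_nonneg_left
      (Real.log_le_log (h0.trans_le (le_law hp k ω)) (law_mono hp h k (hk ω))) (hp ω)

/-- Gibbs' inequality: conditional entropy is at most conditional cross entropy. -/
lemma condEntropy_le_cross [Fintype α] [Fintype β] (hp : ∀ ω, 0 ≤ p ω) (hp1 : ∑ ω, p ω = 1)
    (g : Ω → α) (h : Ω → β) (q : β → α → ℝ) (hq0 : ∀ y x, 0 ≤ q y x)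
    (hq1 : ∀ y, ∑ x, q y x ≤ 1) (hpos : ∀ ω, 0 < p ω → 0 < q (h ω) (g ω)) :
    entropy p (fun ω => (g ω, h ω)) - entropy p h ≤ -∑ ω, p ω * Real.log (q (h ω) (g ω)) := by
  set P := law p (fun ω => (g ω, h ω)) with hP
  set Ph := law p h with hPh
  -- The likelihood ratio of the test law to the true law has mean at most one; `log x ≤ x - 1` then
  -- yields the inequality.
  have key : ∑ ω, p ω * (q (h ω) (g ω) * Ph (h ω) / P (g ω, h ω)) ≤ 1 := by
    have e := sum_law_mul (p := p) (fun ω => (g ω, h ω))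
      (fun z => q z.2 z.1 * Ph z.2 / P z)
    rw [← e]
    calc ∑ z : α × β, P z * (q z.2 z.1 * Ph z.2 / P z)
        ≤ ∑ z : α × β, q z.2 z.1 * Ph z.2 := by
          refine Finset.sum_le_sum fun z _ => ?_
          have h2 : 0 ≤ q z.2 z.1 * Ph z.2 := mul_nonneg (hq0 _ _) (law_nonneg hp _ _)
          by_cases h0 : P z = 0
          · simp [h0, h2]
          · rw [mul_div_cancel₀ _ h0]
      _ = ∑ y, (∑ x, q y x) * Ph y := by
          rw [Fintype.sum_prod_type_right]
          simp [Finset.sum_mul]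
      _ ≤ ∑ y, Ph y := Finset.sum_le_sum fun y _ =>
          mul_le_of_le_one_left (law_nonneg hp _ _) (hq1 y)
      _ = 1 := by
          have := sum_law_mul (p := p) h (fun _ => 1)
          simpa [hp1] using this
  have : ∀ ω, p ω * Real.log (q (h ω) (g ω)) + p ω * Real.log (Ph (h ω))
      - p ω * Real.log (P (g ω, h ω))
      ≤ p ω * (q (h ω) (g ω) * Ph (h ω) / P (g ω, h ω)) - p ω := by
    intro ω
    rcases (hp ω).eq_or_lt with h0 | h0
    · simp [← h0]
    · have a1 := hpos ω h0
      have a2 : 0 < Ph (h ω) := h0.trans_le (le_law hp _ ω)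
      have a3 : 0 < P (g ω, h ω) := h0.trans_le (le_law hp (fun ω => (g ω, h ω)) ω)
      have := Real.log_le_sub_one_of_pos (div_pos (mul_pos a1 a2) a3)
      rw [Real.log_div (mul_pos a1 a2).ne' a3.ne', Real.log_mul a1.ne' a2.ne'] at this
      nlinarith
  have h3 := Finset.sum_le_sum fun ω (_ : ω ∈ Finset.univ) => this ω
  simp only [Finset.sum_sub_distrib, Finset.sum_add_distrib, hp1] at h3
  unfold entropy
  linarith

lemma entropy_le_cross [Fintype α] (hp : ∀ ω, 0 ≤ p ω) (hp1 : ∑ ω, p ω = 1)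
    (g : Ω → α) (q : α → ℝ) (hq0 : ∀ x, 0 ≤ q x) (hq1 : ∑ x, q x ≤ 1)
    (hpos : ∀ ω, 0 < p ω → 0 < q (g ω)) :
    entropy p g ≤ -∑ ω, p ω * Real.log (q (g ω)) := by
  have h := condEntropy_le_cross hp hp1 g (fun _ => ()) (fun _ => q) (fun _ => hq0)
    (fun _ => hq1) hpos
  have h1 : entropy p (fun _ : Ω => ()) = 0 := by simp [entropy, law, hp1]
  have h2 := entropy_mono hp g (fun ω => (g ω, ())) (by simp)
  linarith

lemma entropy_le_log_card [Fintype α] (hp : ∀ ω, 0 ≤ p ω) (hp1 : ∑ ω, p ω = 1) (g : Ω → α) :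
    entropy p g ≤ Real.log (Fintype.card α) := by
  have hne : Nonempty Ω := by
    by_contra h
    rw [not_nonempty_iff] at h
    simp at hp1
  have : Nonempty α := hne.map g
  have hc : (0 : ℝ) < Fintype.card α := by exact_mod_cast Fintype.card_pos
  have h := entropy_le_cross hp hp1 g (fun _ => (Fintype.card α : ℝ)⁻¹) (by intro; positivity)
    (by simp [hc.ne']) (by intros; positivity)
  simpa [← Finset.sum_mul, hp1] using h

/-- Submodularity of entropy. -/
lemma entropy_submodular [Fintype α] [Fintype β] [Fintype γ] (hp : ∀ ω, 0 ≤ p ω)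
    (hp1 : ∑ ω, p ω = 1) (f : Ω → α) (g : Ω → β) (t : Ω → γ) :
    entropy p (fun ω => (f ω, g ω, t ω)) + entropy p t
      ≤ entropy p (fun ω => (f ω, t ω)) + entropy p (fun ω => (g ω, t ω)) := by
  have h := condEntropy_le_cross hp hp1 f (fun ω => (g ω, t ω))
    -- The test law is the conditional law of `f` given `t`, which ignores `g`. Its rows sum to `0`
    -- where `t` has no mass, so only sub-probability rows can be required.
    (fun y x => law p (fun ω => (f ω, t ω)) (x, y.2) / law p t y.2)
    (fun y x => div_nonneg (law_nonneg hp _ _) (law_nonneg hp _ _))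
    (fun y => by
      rw [← Finset.sum_div, sum_law_pair]
      exact div_self_le_one _)
    (fun ω h0 => div_pos (h0.trans_le (le_law hp (fun ω => (f ω, t ω)) ω))
      (h0.trans_le (le_law hp t ω)))
  have e : ∑ ω, p ω * Real.log (law p (fun ω => (f ω, t ω)) (f ω, t ω) / law p t (t ω))
      = -entropy p (fun ω => (f ω, t ω)) + entropy p t := by
    simp only [entropy, neg_neg, ← sub_eq_add_neg, ← Finset.sum_sub_distrib]
    refine Finset.sum_congr rfl fun ω _ => ?_
    rcases (hp ω).eq_or_lt with h0 | h0
    · simp [← h0]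
    · rw [Real.log_div (h0.trans_le (le_law hp (fun ω => (f ω, t ω)) ω)).ne'
        (h0.trans_le (le_law hp t ω)).ne', mul_sub]
  simp only at h
  rw [e] at h
  linarith

/-- Fano's inequality. -/
lemma fano [Fintype α] [DecidableEq α] [Fintype β] (hp : ∀ ω, 0 ≤ p ω) (hp1 : ∑ ω, p ω = 1)
    (w : Ω → α) (m : Ω → β) (dec : β → α) :
    entropy p (fun ω => (w ω, m ω)) - entropy p m
      ≤ Real.log 2 + (∑ ω, if dec (m ω) ≠ w ω then p ω else 0) * Real.log (Fintype.card α) := by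
  have hne : Nonempty Ω := by
    by_contra h
    rw [not_nonempty_iff] at h
    simp at hp1
  have : Nonempty α := hne.map w
  have hc : (0 : ℝ) < Fintype.card α := by exact_mod_cast Fintype.card_pos
  set N : ℝ := (Fintype.card α : ℝ) with hN
  have h := condEntropy_le_cross hp hp1 w m
    -- Half the mass sits on the decoder's guess and half is uniform: a correct guess costs at most
    -- `log 2`, a wrong one `log 2 + log N`.
    (fun y x => (if dec y = x then 1 / 2 else 0) + 1 / (2 * N))
    (fun y x => by split_ifs <;> positivity)
    (fun y => by
      rw [Finset.sum_add_distrib]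
      simp only [Finset.sum_ite_eq, Finset.mem_univ, if_true, Finset.sum_const, nsmul_eq_mul,
        Finset.card_univ, ← hN]
      field_simp
      norm_num)
    (fun ω _ => by split_ifs <;> positivity)
  refine h.trans ?_
  have e : Real.log 2 = ∑ ω, p ω * Real.log 2 := by rw [← Finset.sum_mul, hp1, one_mul]
  rw [e, Finset.sum_mul, ← Finset.sum_add_distrib, ← Finset.sum_neg_distrib]
  refine Finset.sum_le_sum fun ω _ => ?_
  by_cases hd : dec (m ω) = w ω
  · simp only [hd, if_true, ne_eq, not_true_eq_false, if_false, zero_mul, add_zero]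
    have : Real.log (1 / 2) ≤ Real.log (1 / 2 + 1 / (2 * N)) :=
      Real.log_le_log (by norm_num) (le_add_of_nonneg_right (by positivity))
    rw [Real.log_div one_ne_zero two_ne_zero, Real.log_one] at this
    nlinarith [hp ω]
  · simp only [hd, if_false, ne_eq, not_false_eq_true, if_true, zero_add]
    rw [Real.log_div one_ne_zero (by positivity), Real.log_one, Real.log_mul two_ne_zero hc.ne']
    linarith

/-- Submodularity splits `H(a, b, t)` into single-message terms. Each of `H(a, w)` and `H(b, w)` is
at most `H(w, a, b) ≤ H(a, b) + δ`, so dependence between `a` and `b` given `w`, here caused by the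
common interference, does no harm. -/
lemma two_mul_entropy_le {W A B T : Type*} [Fintype W] [Fintype A] [Fintype B] [Fintype T]
    (hp : ∀ ω, 0 ≤ p ω) (hp1 : ∑ ω, p ω = 1) (w : Ω → W) (a : Ω → A) (b : Ω → B) (t : W → T)
    {δ : ℝ}
    (hδ : entropy p (fun ω => (w ω, a ω, b ω)) - entropy p (fun ω => (a ω, b ω)) ≤ δ) :
    2 * entropy p w ≤ entropy p (fun ω => (a ω, b ω)) + entropy p (fun ω => t (w ω))
      + (entropy p (fun ω => (a ω, t (w ω))) - entropy p (fun ω => t (w ω))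
          - (entropy p (fun ω => (a ω, w ω)) - entropy p w))
      + (entropy p (fun ω => (b ω, t (w ω))) - entropy p (fun ω => t (w ω))
          - (entropy p (fun ω => (b ω, w ω)) - entropy p w)) + 2 * δ := by
  have h1 := entropy_submodular hp hp1 a b (fun ω => t (w ω))
  have h2 := entropy_mono hp (fun ω => (a ω, w ω)) (fun ω => (w ω, a ω, b ω)) (by simp_all)
  have h3 := entropy_mono hp (fun ω => (b ω, w ω)) (fun ω => (w ω, a ω, b ω)) (by simp_all)
  have h4 := entropy_mono hp (fun ω => (a ω, b ω)) (fun ω => (a ω, b ω, t (w ω))) (by simp_all)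
  linarith

end Entropy

/-! ### One-shot converse for a finite channel with a genie -/

section OneShot

variable {W A B T : Type*} [Fintype W] [Fintype A] [Fintype B] [Fintype T]

lemma law_fst_of_uniform {A : Type*} [Fintype A] {N : ℝ} (κ : W → A → ℝ)
    (hκ1 : ∀ w, ∑ m, κ w m = 1) (w : W) :
    law (fun ω : W × A => κ ω.1 ω.2 / N) Prod.fst w = 1 / N := by
  classical
  simp only [law, Fintype.sum_prod_type]
  rw [Finset.sum_eq_single w]
  · simp [← Finset.sum_div, hκ1]
  · intro b _ hb; simp [hb]
  · simp

lemma law_comp_pair_of_uniform {M A : Type*} [Fintype M] [DecidableEq A] {N : ℝ} (κ : W → M → ℝ)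
    (g : M → A) (w : W) (a : A) :
    law (fun ω : W × M => κ ω.1 ω.2 / N) (fun ω => (g ω.2, ω.1)) (a, w)
      = (∑ m, if g m = a then κ w m else 0) / N := by
  classical
  simp only [law, Fintype.sum_prod_type]
  rw [Finset.sum_eq_single w]
  · simp only [Prod.mk.injEq, and_true]
    rw [Finset.sum_div]
    refine Finset.sum_congr rfl fun m _ => ?_
    by_cases h : g m = a <;> simp [h]
  · intro b _ hb; simp [hb]
  · simp

/-- The information on `W` in a message `g M`, given `t W`, is at most the mean divergence of
the law of `g M` given `W` from any test law `q (t W)`. -/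
lemma condInfo_le {M A : Type*} [Fintype M] [Fintype A] [DecidableEq A] {N : ℝ} (hN : 0 < N)
    (κ : W → M → ℝ) (hκ : ∀ w m, 0 ≤ κ w m) (hκ1 : ∀ w, ∑ m, κ w m = 1)
    (hNc : N = Fintype.card W) (g : M → A) (t : W → T)
    (k : W → A → ℝ) (hk : ∀ w a, k w a = ∑ m, if g m = a then κ w m else 0)
    (q : T → A → ℝ) (hq0 : ∀ y x, 0 ≤ q y x)
    (hq1 : ∀ y, ∑ x, q y x ≤ 1) (hpos : ∀ w a, 0 < k w a → 0 < q (t w) a) {D : ℝ}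
    (hD : ∀ w, ∑ a, k w a * Real.log (k w a / q (t w) a) ≤ D) :
    (entropy (fun ω : W × M => κ ω.1 ω.2 / N) (fun ω => (g ω.2, t ω.1))
        - entropy (fun ω : W × M => κ ω.1 ω.2 / N) (fun ω => t ω.1))
      - (entropy (fun ω : W × M => κ ω.1 ω.2 / N) (fun ω => (g ω.2, ω.1))
        - entropy (fun ω : W × M => κ ω.1 ω.2 / N) Prod.fst) ≤ D := by
  set p : W × M → ℝ := fun ω => κ ω.1 ω.2 / N with hp
  have hp0 : ∀ ω, 0 ≤ p ω := fun ω => div_nonneg (hκ _ _) hN.le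
  have hp1 : ∑ ω, p ω = 1 := by
    simp only [hp, Fintype.sum_prod_type, ← Finset.sum_div, hκ1]
    simp [← hNc, hN.ne']
  have kpos : ∀ ω, 0 < p ω → 0 < k ω.1 (g ω.2) := by
    intro ω h
    have := h.trans_le (le_law hp0 (fun ω => (g ω.2, ω.1)) ω)
    rw [hp, law_comp_pair_of_uniform, ← hk] at this
    exact (div_pos_iff_of_pos_right hN).1 this
  have h1 := condEntropy_le_cross hp0 hp1 (fun ω => g ω.2) (fun ω => t ω.1) q hq0 hq1
    (fun ω h => hpos _ _ (kpos ω h))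
  have h2 : entropy p (fun ω => (g ω.2, ω.1)) - entropy p Prod.fst
      = -∑ ω, p ω * Real.log (k ω.1 (g ω.2)) := by
    unfold entropy
    rw [← neg_sub_neg, neg_neg, neg_neg, ← neg_sub, ← Finset.sum_sub_distrib]
    congr 1
    refine Finset.sum_congr rfl fun ω _ => ?_
    rcases (hp0 ω).eq_or_lt with h0 | h0
    · simp [← h0]
    · rw [hp, law_comp_pair_of_uniform, ← hk, law_fst_of_uniform _ hκ1,
        Real.log_div (kpos ω h0).ne' hN.ne', Real.log_div one_ne_zero hN.ne', Real.log_one]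
      ring
  have h3 : ∑ ω, p ω * Real.log (k ω.1 (g ω.2)) - ∑ ω, p ω * Real.log (q (t ω.1) (g ω.2))
      = ∑ ω, p ω * Real.log (k ω.1 (g ω.2) / q (t ω.1) (g ω.2)) := by
    rw [← Finset.sum_sub_distrib]
    refine Finset.sum_congr rfl fun ω _ => ?_
    rcases (hp0 ω).eq_or_lt with h0 | h0
    · simp [← h0]
    · rw [Real.log_div (kpos ω h0).ne' (hpos _ _ (kpos ω h0)).ne', mul_sub]
  have h4 : ∑ ω, p ω * Real.log (k ω.1 (g ω.2) / q (t ω.1) (g ω.2))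
      = (∑ w, ∑ a, k w a * Real.log (k w a / q (t w) a)) / N := by
    rw [Fintype.sum_prod_type, Finset.sum_div]
    refine Finset.sum_congr rfl fun w _ => ?_
    -- Summing over messages `m` and grouping them by the value of `g m` turns the mean log-ratio
    -- into the divergence for each `w`.
    simp only [hk w, Finset.sum_mul]
    rw [Finset.sum_comm, Finset.sum_div]
    refine Finset.sum_congr rfl fun m _ => ?_
    rw [Finset.sum_eq_single (g m)]
    · simp [hp]; ring
    · intro b _ hb; simp [hb.symm]
    · simp
  have h5 : (∑ w, ∑ a, k w a * Real.log (k w a / q (t w) a)) / N ≤ D := by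
    rw [div_le_iff₀ hN]
    refine (Finset.sum_le_sum fun w _ => hD w).trans ?_
    simp [hNc, mul_comm]
  linarith

/-- One-shot converse with the genie `t W`. -/
theorem log_card_le_of_genie [Nonempty W] [DecidableEq W] [DecidableEq A] [DecidableEq B]
    (κ : W → A × B → ℝ) (hκ : ∀ w m, 0 ≤ κ w m) (hκ1 : ∀ w, ∑ m, κ w m = 1)
    (dec : A × B → W) (t : W → T) (r : T → ℝ) (hr : ∀ y, 0 < r y) (hr1 : ∑ y, r y ≤ 1)
    (k₁ : W → A → ℝ) (hk₁ : ∀ w a, k₁ w a = ∑ m, if m.1 = a then κ w m else 0)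
    (k₂ : W → B → ℝ) (hk₂ : ∀ w b, k₂ w b = ∑ m, if m.2 = b then κ w m else 0)
    (q₁ : T → A → ℝ) (hq₁ : ∀ y x, 0 ≤ q₁ y x) (hq₁' : ∀ y, ∑ x, q₁ y x ≤ 1)
    (hpos₁ : ∀ w a, 0 < k₁ w a → 0 < q₁ (t w) a)
    (q₂ : T → B → ℝ) (hq₂ : ∀ y x, 0 ≤ q₂ y x) (hq₂' : ∀ y, ∑ x, q₂ y x ≤ 1)
    (hpos₂ : ∀ w b, 0 < k₂ w b → 0 < q₂ (t w) b) {D : ℝ}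
    (hD₁ : ∀ w, ∑ a, k₁ w a * Real.log (k₁ w a / q₁ (t w) a) ≤ D)
    (hD₂ : ∀ w, ∑ b, k₂ w b * Real.log (k₂ w b / q₂ (t w) b) ≤ D) {ε : ℝ}
    (hε : (∑ w, ∑ m, if dec m ≠ w then κ w m else 0) / (Fintype.card W : ℝ) ≤ ε) :
    2 * (1 - ε) * Real.log (Fintype.card W) ≤ Real.log (Fintype.card A) + Real.log (Fintype.card B)
      - (∑ w, Real.log (r (t w))) / Fintype.card W + 2 * D + 2 * Real.log 2 := by
  have hN : (0 : ℝ) < Fintype.card W := by exact_mod_cast Fintype.card_pos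
  obtain ⟨N, hNc⟩ : ∃ N : ℝ, N = Fintype.card W := ⟨_, rfl⟩
  rw [← hNc] at hN hε ⊢
  set p : W × A × B → ℝ := fun ω => κ ω.1 ω.2 / N with hp
  have hp0 : ∀ ω, 0 ≤ p ω := fun ω => div_nonneg (hκ _ _) hN.le
  have hp1 : ∑ ω, p ω = 1 := by
    simp only [hp, Fintype.sum_prod_type (α₁ := W), ← Finset.sum_div, hκ1]
    simp [← hNc, hN.ne']
  have hne : Nonempty (A × B) := by
    by_contra h
    rw [not_nonempty_iff] at h
    have := hκ1 (Classical.arbitrary W)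
    simp at this
  have : Nonempty A := hne.map Prod.fst
  have : Nonempty B := hne.map Prod.snd
  have hlogN : 0 ≤ Real.log N := Real.log_nonneg (by
    rw [hNc]; exact_mod_cast Fintype.card_pos)
  have F := fano hp0 hp1 Prod.fst (fun ω => (ω.2.1, ω.2.2)) dec
  have F2 : (∑ ω : W × A × B, if dec (ω.2.1, ω.2.2) ≠ ω.1 then p ω else 0) ≤ ε := by
    refine le_trans (le_of_eq ?_) hε
    rw [Fintype.sum_prod_type, Finset.sum_div]
    refine Finset.sum_congr rfl fun w _ => ?_
    rw [Finset.sum_div]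
    refine Finset.sum_congr rfl fun m _ => ?_
    by_cases h : dec m = w <;> simp [h, hp]
  rw [← hNc] at F
  have F3 : _ ≤ Real.log 2 + ε * Real.log N := F.trans (by gcongr)
  have S := two_mul_entropy_le hp0 hp1 Prod.fst (fun ω => ω.2.1) (fun ω => ω.2.2) t F3
  have I1 := condInfo_le hN κ hκ hκ1 hNc Prod.fst t k₁ hk₁ q₁ hq₁ hq₁' hpos₁ hD₁
  have I2 := condInfo_le hN κ hκ hκ1 hNc Prod.snd t k₂ hk₂ q₂ hq₂ hq₂' hpos₂ hD₂
  have E1 : entropy p Prod.fst = Real.log N := by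
    unfold entropy
    have : ∀ ω : W × A × B, law p Prod.fst ω.1 = 1 / N := fun ω => law_fst_of_uniform κ hκ1 ω.1
    simp only [this, one_div, Real.log_inv, ← Finset.sum_mul, hp1]
    ring
  have E2 := entropy_le_log_card hp0 hp1 (fun ω => (ω.2.1, ω.2.2))
  rw [Fintype.card_prod, Nat.cast_mul, Real.log_mul
    (by exact_mod_cast Fintype.card_ne_zero) (by exact_mod_cast Fintype.card_ne_zero)] at E2
  have E3 := entropy_le_cross hp0 hp1 (fun ω => t ω.1) r (fun y => (hr y).le) hr1
    (fun ω _ => hr _)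
  have E4 : ∑ ω, p ω * Real.log (r (t ω.1)) = (∑ w, Real.log (r (t w))) / N := by
    rw [Fintype.sum_prod_type, Finset.sum_div]
    refine Finset.sum_congr rfl fun w _ => ?_
    simp only [hp]
    rw [← Finset.sum_mul, ← Finset.sum_div, hκ1]
    ring
  rw [E4] at E3
  rw [E1] at S I1 I2
  simp only [← hp] at I1 I2
  linarith

end OneShot

/-! ### Gaussian likelihood ratios and data processing -/

section ChangeOfMeasure

lemma pi_withDensity_ofReal {ι : Type*} [Fintype ι] {E : ι → Type*} [∀ i, MeasurableSpace (E i)]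
    (μ ν : (i : ι) → Measure (E i)) [∀ i, IsFiniteMeasure (μ i)] [∀ i, IsFiniteMeasure (ν i)]
    (f : (i : ι) → E i → ℝ) (hf : ∀ i, Measurable (f i)) (hf0 : ∀ i y, 0 ≤ f i y)
    (h : ∀ i, ν i = (μ i).withDensity fun y => ENNReal.ofReal (f i y)) :
    Measure.pi ν = (Measure.pi μ).withDensity fun y => ENNReal.ofReal (∏ i, f i (y i)) := by
  have hint : ∀ i, Integrable (f i) (μ i) := fun i => by
    refine ⟨(hf i).aestronglyMeasurable, ?_⟩
    rw [hasFiniteIntegral_iff_ofReal (ae_of_all _ (hf0 i)), ← setLIntegral_univ,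
      ← withDensity_apply _ MeasurableSet.univ, ← h]
    exact measure_lt_top _ _
  refine Measure.pi_eq fun s hs => ?_
  have hi : ∀ i, Integrable ((s i).indicator (f i)) (μ i) := fun i => (hint i).indicator (hs i)
  have hi0 : ∀ i y, 0 ≤ (s i).indicator (f i) y := fun i y =>
    Set.indicator_nonneg (fun y _ => hf0 i y) y
  have e1 : ∀ i, ν i (s i) = ENNReal.ofReal (∫ y, (s i).indicator (f i) y ∂μ i) := fun i => by
    rw [h, withDensity_apply _ (hs i), integral_indicator (hs i),
      ofReal_integral_eq_lintegral_ofReal (hint i).integrableOn (ae_of_all _ (hf0 i))]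
  have hI : Integrable (fun y : (i : ι) → E i => ∏ i, (s i).indicator (f i) (y i))
      (Measure.pi μ) := Integrable.fintype_prod_dep hi
  simp only [e1]
  rw [← ENNReal.ofReal_prod_of_nonneg fun i _ => integral_nonneg (hi0 i),
    ← integral_fintype_prod_eq_prod,
    withDensity_apply _ (MeasurableSet.univ_pi hs),
    ofReal_integral_eq_lintegral_ofReal hI
      (ae_of_all _ fun y => Finset.prod_nonneg fun i _ => hi0 i _),
    ← lintegral_indicator (MeasurableSet.univ_pi hs)]
  refine lintegral_congr fun y => ?_
  by_cases hy : y ∈ Set.univ.pi s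
  · rw [Set.indicator_of_mem hy]
    congr 1
    refine Finset.prod_congr rfl fun i _ => ?_
    rw [Set.indicator_of_mem (hy i (Set.mem_univ i))]
  · rw [Set.indicator_of_notMem hy]
    simp only [Set.mem_pi, Set.mem_univ, true_imp_iff, not_forall] at hy
    obtain ⟨i, hi⟩ := hy
    rw [Finset.prod_eq_zero (Finset.mem_univ i) (Set.indicator_of_notMem hi _), ENNReal.ofReal_zero]

lemma gaussianReal_eq_withDensity (c x : ℝ) {v : ℝ≥0} (hv : v ≠ 0) :
    gaussianReal c v = (gaussianReal x v).withDensity fun y =>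
      ENNReal.ofReal (Real.exp (-(((x - c) * (y - x) + (x - c) ^ 2 / 2) / v))) := by
  have hv' : (v : ℝ) ≠ 0 := by exact_mod_cast hv
  rw [gaussianReal_of_var_ne_zero _ hv, gaussianReal_of_var_ne_zero _ hv,
    ← withDensity_mul _ (measurable_gaussianPDF _ _) (by fun_prop)]
  congr 1
  funext y
  simp only [Pi.mul_apply, gaussianPDF]
  rw [← ENNReal.ofReal_mul (gaussianPDFReal_nonneg _ _ _)]
  congr 1
  simp only [gaussianPDFReal, mul_assoc, ← Real.exp_add]
  congr 2
  field_simp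
  ring

lemma pi_gaussianReal_eq_withDensity {n : ℕ} (c x : Fin n → ℝ) {v : ℝ≥0} (hv : v ≠ 0) :
    Measure.pi (fun k => gaussianReal (c k) v)
      = (Measure.pi fun k => gaussianReal (x k) v).withDensity fun y => ENNReal.ofReal
        (Real.exp (-∑ k, ((x k - c k) * (y k - x k) + (x k - c k) ^ 2 / 2) / v)) := by
  rw [pi_withDensity_ofReal (fun k => gaussianReal (x k) v) (fun k => gaussianReal (c k) v)
    (fun k y => Real.exp (-(((x k - c k) * (y - x k) + (x k - c k) ^ 2 / 2) / v)))
    (fun k => by fun_prop) (fun k y => (Real.exp_pos _).le)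
    (fun k => gaussianReal_eq_withDensity _ _ hv)]
  simp only [← Finset.sum_neg_distrib, Real.exp_sum]

/-- The integrand is the log-likelihood ratio of means `x` against means `c`, so for `v ≠ 0` its
integral is the divergence; the linear term is centred and only the quadratic one survives. -/
lemma integral_logRatio_pi_gaussianReal {n : ℕ} (c x : Fin n → ℝ) (v : ℝ≥0) :
    Integrable (fun y : Fin n → ℝ => ∑ k, ((x k - c k) * (y k - x k) + (x k - c k) ^ 2 / 2) / (v : ℝ))
      (Measure.pi fun k => gaussianReal (x k) v) ∧
    ∫ y, ∑ k, ((x k - c k) * (y k - x k) + (x k - c k) ^ 2 / 2) / (v : ℝ)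
      ∂(Measure.pi fun k => gaussianReal (x k) v) = (∑ k, (x k - c k) ^ 2) / (2 * v) := by
  have hi : ∀ k, Integrable (fun y : ℝ => y) (gaussianReal (x k) v) := fun k =>
    (memLp_id_gaussianReal 1).integrable le_rfl
  have hj : ∀ k, Integrable (fun y : ℝ => ((x k - c k) * (y - x k) + (x k - c k) ^ 2 / 2) / v)
      (gaussianReal (x k) v) := fun k =>
    ((((hi k).sub (integrable_const _)).const_mul _).add (integrable_const _)).div_const _
  have mp := fun k => measurePreserving_eval (fun k => gaussianReal (x k) v) k
  have hk : ∀ k, Integrable (fun y : Fin n → ℝ =>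
      ((x k - c k) * (y k - x k) + (x k - c k) ^ 2 / 2) / (v : ℝ))
      (Measure.pi fun k => gaussianReal (x k) v) := fun k =>
    (mp k).integrable_comp_of_integrable (hj k)
  refine ⟨integrable_finsetSum _ fun k _ => hk k, ?_⟩
  rw [integral_finsetSum _ fun k _ => hk k, Finset.sum_div]
  refine Finset.sum_congr rfl fun k _ => ?_
  have e := integral_map (mp k).aemeasurable (f := fun y : ℝ =>
    ((x k - c k) * (y - x k) + (x k - c k) ^ 2 / 2) / v)
    (by rw [(mp k).map_eq]; exact (hj k).aestronglyMeasurable)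
  rw [(mp k).map_eq] at e
  simp only [Function.eval] at e
  have hs : Integrable (fun y : ℝ => y - x k) (gaussianReal (x k) v) :=
    (hi k).sub (integrable_const _)
  rw [← e, integral_div, integral_add (hs.const_mul _)
    (integrable_const _), integral_const_mul, integral_sub (hi k) (integrable_const _),
    integral_id_gaussianReal]
  simp
  ring

variable {α A : Type*} [MeasurableSpace α] [Fintype A] [MeasurableSpace A]
  [MeasurableSingletonClass A]

lemma real_eq_setIntegral_exp {P Q : Measure α} [IsFiniteMeasure Q] {L : α → ℝ}
    (hL : Measurable L)
    (hQ : Q = P.withDensity fun y => ENNReal.ofReal (Real.exp (-L y))) :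
    Integrable (fun y => Real.exp (-L y)) P ∧
      ∀ S, MeasurableSet S → Q.real S = ∫ y in S, Real.exp (-L y) ∂P := by
  have hi : Integrable (fun y => Real.exp (-L y)) P := by
    refine ⟨by fun_prop, ?_⟩
    rw [hasFiniteIntegral_iff_ofReal (ae_of_all _ fun y => (Real.exp_pos _).le),
      ← setLIntegral_univ, ← withDensity_apply _ MeasurableSet.univ, ← hQ]
    exact measure_lt_top _ _
  refine ⟨hi, fun S hS => ?_⟩
  rw [Measure.real, hQ, withDensity_apply _ hS,
    integral_eq_lintegral_of_nonneg_ae (ae_of_all _ fun y => (Real.exp_pos _).le)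
      hi.integrableOn.aestronglyMeasurable]

lemma real_pos_of_withDensity_exp {P Q : Measure α} [IsFiniteMeasure P] [IsFiniteMeasure Q]
    {L : α → ℝ} (hL : Measurable L)
    (hQ : Q = P.withDensity fun y => ENNReal.ofReal (Real.exp (-L y))) {S : Set α}
    (hS : MeasurableSet S) (h : 0 < P.real S) : 0 < Q.real S := by
  obtain ⟨hi, he⟩ := real_eq_setIntegral_exp hL hQ
  rw [he S hS]
  have : NeZero (P.restrict S) := ⟨fun h0 => by
    rw [Measure.restrict_eq_zero] at h0
    simp [Measure.real, h0] at h⟩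
  exact integral_exp_pos hi.integrableOn

/-- Data processing for a finite-valued observation. -/
lemma sum_mul_log_le_integral {P Q : Measure α} [IsProbabilityMeasure P] [IsProbabilityMeasure Q]
    {L : α → ℝ} (hL : Measurable L) (hLi : Integrable L P)
    (hQ : Q = P.withDensity fun y => ENNReal.ofReal (Real.exp (-L y))) {f : α → A}
    (hf : Measurable f) :
    ∑ a, P.real (f ⁻¹' {a}) * Real.log (P.real (f ⁻¹' {a}) / Q.real (f ⁻¹' {a})) ≤ ∫ y, L y ∂P := by
  obtain ⟨hi, he⟩ := real_eq_setIntegral_exp hL hQ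
  have hm : ∀ a, MeasurableSet (f ⁻¹' {a}) := fun a => hf (measurableSet_singleton a)
  have hu : ∫ y, L y ∂P = ∑ a, ∫ y in f ⁻¹' {a}, L y ∂P := by
    rw [← integral_iUnion_fintype hm _ fun a => hLi.integrableOn]
    · have : ⋃ a, f ⁻¹' {a} = Set.univ := by ext; simp
      rw [this, setIntegral_univ]
    · intro a b hab
      exact Disjoint.preimage f (by simpa using hab)
  rw [hu]
  refine Finset.sum_le_sum fun a _ => ?_
  set S := f ⁻¹' {a}
  rcases (measureReal_nonneg (μ := P) (s := S)).eq_or_lt with h0 | h0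
  · rw [← h0, zero_mul]
    have : P S = 0 := (measureReal_eq_zero_iff).1 h0.symm
    rw [Measure.restrict_eq_zero.2 this, integral_zero_measure]
  · have h1 := real_pos_of_withDensity_exp hL hQ (hm a) h0
    set p := P.real S
    set q := Q.real S with hq
    -- This is `log x ≤ x - 1` at `x = (p / q) exp (-L)`. Integrated over the fibre, the last two
    -- terms on the left cancel, leaving `p log (p / q)`.
    have hle : ∫ y in S, (Real.log (p / q) + 1 - p / q * Real.exp (-L y)) ∂P ≤ ∫ y in S, L y ∂P := by
      refine integral_mono ((integrable_const _).sub (hi.integrableOn.const_mul _))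
        hLi.integrableOn fun y => ?_
      have := Real.log_le_sub_one_of_pos (mul_pos (div_pos h0 h1) (Real.exp_pos (-L y)))
      rw [Real.log_mul (div_pos h0 h1).ne' (Real.exp_pos _).ne', Real.log_exp] at this
      simp only
      linarith
    refine le_trans (le_of_eq ?_) hle
    rw [integral_sub (integrable_const _) (hi.integrableOn.const_mul _), integral_const_mul,
      ← he _ (hm a), integral_const, ← hq]
    simp only [measureReal_restrict_apply_univ, smul_eq_mul]
    change _ = p * _ - _
    field_simp
    ring

end ChangeOfMeasure

/-! ### Discrete Gaussian test law and rounding estimates -/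

section Quantizer

/-- The term at `0` is `1`, and on each side monotonicity bounds the sum by half the Gaussian
integral. -/
lemma sum_exp_neg_mul_sq_le {l : ℝ} (hl : 0 < l) (S : Finset ℤ) :
    ∑ j ∈ S, Real.exp (-l * (j : ℝ) ^ 2) ≤ 1 + √(Real.pi / l) := by
  obtain ⟨f, hf⟩ : ∃ f : ℝ → ℝ, ∀ x, f x = Real.exp (-l * x ^ 2) := ⟨_, fun _ => rfl⟩
  have hf0 : ∀ x, 0 ≤ f x := fun x => by rw [hf]; positivity
  have hint : IntegrableOn f (Set.Ioi 0) := by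
    rw [funext hf]; exact (integrable_exp_neg_mul_sq hl).integrableOn
  have hb : ∀ M : ℕ, ∑ i ∈ Finset.range M, f ((i : ℝ) + 1) ≤ √(Real.pi / l) / 2 := by
    intro M
    have anti : AntitoneOn f (Set.Icc 0 (0 + (M : ℝ))) := by
      intro x hx y hy hxy
      have hx0 := hx.1
      simp only [hf, Real.exp_le_exp, neg_mul, neg_le_neg_iff]
      gcongr
    have h := anti.sum_le_integral
    simp only [zero_add, Nat.cast_add, Nat.cast_one] at h
    refine h.trans ?_
    rw [intervalIntegral.integral_of_le (Nat.cast_nonneg M), ← integral_gaussian_Ioi, ← funext hf]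
    exact setIntegral_mono_set hint (ae_of_all _ hf0)
      (Set.Ioc_subset_Ioi_self.eventuallyLE)
  have hs : Summable fun i : ℕ => f ((i : ℝ) + 1) :=
    summable_of_sum_range_le (fun i => hf0 _) hb
  have ht : ∑' i : ℕ, f ((i : ℝ) + 1) ≤ √(Real.pi / l) / 2 :=
    hs.tsum_le_of_sum_range_le hb
  have hs0 : Summable fun i : ℕ => f ((i : ℤ) : ℝ) := by
    rw [← summable_nat_add_iff 1]
    simpa using hs
  have hneg : ∀ i : ℕ, f ((-((i : ℤ) + 1) : ℤ) : ℝ) = f ((i : ℝ) + 1) := fun i => by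
    rw [hf, hf]
    congr 2
    push_cast
    ring
  have hs1 : Summable fun i : ℕ => f ((-((i : ℤ) + 1) : ℤ) : ℝ) := by
    simpa only [hneg] using hs
  have hz : Summable fun j : ℤ => f (j : ℝ) := Summable.of_nat_of_neg_add_one (f := fun j : ℤ => f (j : ℝ)) hs0 hs1
  have e0 : f (((0 : ℕ) : ℤ) : ℝ) = 1 := by rw [hf]; simp
  have e1 : ∑' i : ℕ, f ((-((i : ℤ) + 1) : ℤ) : ℝ) = ∑' i : ℕ, f ((i : ℝ) + 1) :=
    tsum_congr fun i => hneg i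
  have e2 : ∑' i : ℕ, f (((i + 1 : ℕ) : ℤ) : ℝ) = ∑' i : ℕ, f ((i : ℝ) + 1) :=
    tsum_congr fun i => by congr 1; push_cast; ring
  have e3 := tsum_of_nat_of_neg_add_one (f := fun j : ℤ => f (j : ℝ)) hs0 hs1
  beta_reduce at e3
  have e4 := hs0.tsum_eq_zero_add
  have e5 : ∑ j ∈ S, f (j : ℝ) ≤ ∑' j : ℤ, f (j : ℝ) := hz.sum_le_tsum S fun j _ => hf0 _
  rw [e2, e0] at e4
  rw [e1, e4] at e3
  simp only [hf] at e5 e3 ht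
  linarith

lemma sum_prod_exp_div_le_one {n : ℕ} {l Z : ℝ} (hl : 0 < l) (hZ : 1 + √(Real.pi / l) ≤ Z)
    (S : Finset (Fin n → ℤ)) :
    ∑ y ∈ S, ∏ k, (Real.exp (-l * (y k : ℝ) ^ 2) / Z) ≤ 1 := by
  classical
  have hZ0 : 0 < Z := lt_of_lt_of_le (by positivity) hZ
  refine (Finset.sum_le_sum_of_subset_of_nonneg
    (t := Fintype.piFinset fun k => S.image fun y => y k) (fun y hy => ?_)
    fun y _ _ => Finset.prod_nonneg fun k _ => by positivity).trans ?_
  · rw [Fintype.mem_piFinset]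
    exact fun k => Finset.mem_image_of_mem _ hy
  · rw [← Finset.prod_univ_sum (fun k => S.image fun y : Fin n → ℤ => y k)
      (fun _ j => Real.exp (-l * (j : ℝ) ^ 2) / Z)]
    refine Finset.prod_le_one (fun k _ => Finset.sum_nonneg fun j _ => by positivity) fun k _ => ?_
    rw [← Finset.sum_div, div_le_one hZ0]
    exact (sum_exp_neg_mul_sq_le hl _).trans hZ

/-- Since `|round x| ≤ |x| + 1/2`, it is enough that `|x| ≤ x² / 4 + 1`. This transfers the power
constraint to the quantized input. -/
lemma sq_round_le (x : ℝ) : (round x : ℝ) ^ 2 ≤ 5 / 4 * (x ^ 2 + 1) := by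
  have h := abs_le.1 (abs_sub_round x)
  nlinarith [sq_nonneg (|x| / 2 - 1), sq_abs x, abs_nonneg x, le_abs_self x, neg_abs_le x,
    sq_nonneg (x - 2), sq_nonneg (x + 2)]

lemma sq_sub_mul_round_le {d : ℝ} (hd : 0 < d) (x : ℝ) :
    (x - d * round (x / d)) ^ 2 ≤ d ^ 2 / 4 := by
  have h := abs_le.1 (abs_sub_round (x / d))
  have e : x - d * round (x / d) = d * (x / d - round (x / d)) := by field_simp
  rw [e, mul_pow]
  have : (x / d - round (x / d)) ^ 2 ≤ 1 / 4 := by nlinarith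
  nlinarith [sq_nonneg d]

end Quantizer

/-! ### Output laws at each relay for a fixed input -/

section OutputLaw

variable (N : Network)

instance : IsProbabilityMeasure N.noise := by unfold Network.noise; infer_instance

instance (n : ℕ) : IsProbabilityMeasure (N.noiseN n) := by unfold Network.noiseN; infer_instance

@[fun_prop]
lemma Network.measurable_out1 (x : ℝ) : Measurable (N.out1 x) := by
  unfold Network.out1; fun_prop

@[fun_prop]
lemma Network.measurable_out2 (x : ℝ) : Measurable (N.out2 x) := by
  unfold Network.out2; fun_prop

lemma Network.map_out1_noise (x : ℝ) :
    N.noise.map (N.out1 x) = gaussianReal (N.a * x) (N.PJ + N.PN1) := by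
  have e : N.out1 x = (fun s => N.a * x + s) ∘ (fun p : ℝ × ℝ => p.1 + p.2) ∘ Prod.map id Prod.fst := by
    funext z; simp [Network.out1, add_assoc]
  rw [e, ← Measure.map_map (by fun_prop) (by fun_prop), ← Measure.map_map (by fun_prop) (by fun_prop),
    Network.noise, ← Measure.map_prod_map _ _ measurable_id measurable_fst, Measure.map_id,
    Measure.map_fst_prod, measure_univ, one_smul]
  change Measure.map _ (Measure.conv _ _) = _
  rw [gaussianReal_conv_gaussianReal, gaussianReal_map_const_add]
  simp

lemma Network.map_out2_noise (x : ℝ) :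
    N.noise.map (N.out2 x) = gaussianReal (N.b * x) (N.PJ + N.PN2) := by
  have e : N.out2 x = (fun s => N.b * x + s) ∘ (fun p : ℝ × ℝ => p.1 + p.2) ∘ Prod.map id Prod.snd := by
    funext z; simp [Network.out2, add_assoc]
  rw [e, ← Measure.map_map (by fun_prop) (by fun_prop), ← Measure.map_map (by fun_prop) (by fun_prop),
    Network.noise, ← Measure.map_prod_map _ _ measurable_id measurable_snd, Measure.map_id,
    Measure.map_snd_prod, measure_univ, one_smul]
  change Measure.map _ (Measure.conv _ _) = _
  rw [gaussianReal_conv_gaussianReal, gaussianReal_map_const_add]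
  simp

lemma Network.map_out1_noiseN {n : ℕ} (x : Fin n → ℝ) :
    (N.noiseN n).map (fun z k => N.out1 (x k) (z k))
      = Measure.pi fun k => gaussianReal (N.a * x k) (N.PJ + N.PN1) := by
  have : ∀ k, IsProbabilityMeasure (N.noise.map (N.out1 (x k))) := fun k =>
    Measure.isProbabilityMeasure_map (by fun_prop)
  rw [Network.noiseN, Measure.pi_map_pi fun k => (N.measurable_out1 (x k)).aemeasurable]
  simp only [map_out1_noise]

lemma Network.map_out2_noiseN {n : ℕ} (x : Fin n → ℝ) :
    (N.noiseN n).map (fun z k => N.out2 (x k) (z k))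
      = Measure.pi fun k => gaussianReal (N.b * x k) (N.PJ + N.PN2) := by
  have : ∀ k, IsProbabilityMeasure (N.noise.map (N.out2 (x k))) := fun k =>
    Measure.isProbabilityMeasure_map (by fun_prop)
  rw [Network.noiseN, Measure.pi_map_pi fun k => (N.measurable_out2 (x k)).aemeasurable]
  simp only [map_out2_noise]

end OutputLaw

/-! ### Converse for block codes -/

section Converse

lemma sum_mul_log_pi_gaussianReal_le {n : ℕ} {A : Type*} [Fintype A] [MeasurableSpace A]
    [MeasurableSingletonClass A] {f : (Fin n → ℝ) → A} (hf : Measurable f) (x c : Fin n → ℝ)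
    {v : ℝ≥0} (hv : v ≠ 0) :
    (∑ a, (Measure.pi fun k => gaussianReal (x k) v).real (f ⁻¹' {a}) *
      Real.log ((Measure.pi fun k => gaussianReal (x k) v).real (f ⁻¹' {a}) /
        (Measure.pi fun k => gaussianReal (c k) v).real (f ⁻¹' {a}))
      ≤ (∑ k, (x k - c k) ^ 2) / (2 * v)) ∧
    ∀ a, 0 < (Measure.pi fun k => gaussianReal (x k) v).real (f ⁻¹' {a}) →
      0 < (Measure.pi fun k => gaussianReal (c k) v).real (f ⁻¹' {a}) := by
  have h := integral_logRatio_pi_gaussianReal c x v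
  have hm : Measurable fun y : Fin n → ℝ =>
      ∑ k, ((x k - c k) * (y k - x k) + (x k - c k) ^ 2 / 2) / (v : ℝ) := by fun_prop
  refine ⟨?_, fun a ha => ?_⟩
  · rw [← h.2]
    exact sum_mul_log_le_integral hm h.1 (pi_gaussianReal_eq_withDensity c x hv) hf
  · exact real_pos_of_withDensity_exp hm (pi_gaussianReal_eq_withDensity c x hv)
      (hf (measurableSet_singleton a)) ha

lemma sum_ite_measureReal_preimage {Ω M : Type*} [MeasurableSpace Ω] [Fintype M]
    [MeasurableSpace M] [MeasurableSingletonClass M] (μ : Measure Ω) [IsFiniteMeasure μ]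
    {f : Ω → M} (hf : Measurable f) (p : M → Prop) [DecidablePred p] :
    (∑ m, if p m then μ.real (f ⁻¹' {m}) else 0) = μ.real {z | p (f z)} := by
  rw [← Finset.sum_filter, sum_measureReal_preimage_singleton]
  · congr 1
    ext z
    simp
  · exact fun m _ => hf (measurableSet_singleton m)

/-- The constant `3 / 4` is `1 / 2` from the mean exponent of the discrete Gaussian plus `1 / 8`
nats, counted twice, for each relay. -/
lemma log_le_of_errorProb_le {N : Network} (hPJ : 0 < N.PJ) (ha : N.a ^ 2 ≤ 1) (hb : N.b ^ 2 ≤ 1)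
    {n : ℕ} {R : ℝ} (c : N.Code n R) (hW : 0 < numIndices (n * R)) {ε : ℝ}
    (hε : c.errorProb ≤ ε) :
    2 * (1 - ε) * Real.log (numIndices (n * R))
      ≤ Real.log (numIndices (n * N.C1)) + Real.log (numIndices (n * N.C2))
        + n * (Real.log (1 + N.PX / N.PJ) / 2 + Real.log (1 + √(5 * Real.pi / 2)) + 3 / 4)
        + 2 * Real.log 2 := by
  classical
  have hne : Nonempty (Fin (numIndices (n * R))) := ⟨⟨0, hW⟩⟩
  have hW' : (0 : ℝ) < numIndices (n * R) := by exact_mod_cast hW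
  set d : ℝ := √N.PJ with hd
  have hPJ' : (0 : ℝ) < N.PJ := by exact_mod_cast hPJ
  have hd0 : 0 < d := Real.sqrt_pos.2 hPJ'
  have hd2 : d ^ 2 = N.PJ := Real.sq_sqrt hPJ'.le
  set ρ : ℝ := N.PX / N.PJ with hρ
  have hρ0 : 0 ≤ ρ := by positivity
  set T : Fin (numIndices (n * R)) → Fin n → ℤ := fun w k => round (c.enc w k / d) with hT
  -- Only finitely many grid points arise from codewords; restricting to them makes the genie
  -- finite-valued.
  set S : Finset (Fin n → ℤ) := Finset.univ.image T with hS
  set t : Fin (numIndices (n * R)) → S := fun w =>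
    ⟨T w, Finset.mem_image_of_mem _ (Finset.mem_univ w)⟩ with ht
  -- Chosen so that `l * (5 / 4) * (1 + ρ) = 1 / 2`: under the power constraint the mean exponent
  -- per coordinate is at most `1 / 2`.
  set l : ℝ := 2 / 5 / (1 + ρ) with hl
  have hl0 : 0 < l := by positivity
  set Z : ℝ := √(1 + ρ) * (1 + √(5 * Real.pi / 2)) with hZ
  have hZ0 : 0 < Z := by positivity
  have hZle : 1 + √(Real.pi / l) ≤ Z := by
    have e : Real.pi / l = (1 + ρ) * (5 * Real.pi / 2) := by
      rw [hl]; field_simp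
    rw [e, Real.sqrt_mul (by positivity), hZ, mul_add, mul_one]
    have : 1 ≤ √(1 + ρ) := Real.one_le_sqrt.2 (by linarith)
    linarith
  have hv1 : N.PJ + N.PN1 ≠ 0 := by positivity
  have hv2 : N.PJ + N.PN2 ≠ 0 := by positivity
  set f : Fin (numIndices (n * R)) → (Fin n → ℝ × ℝ × ℝ) →
      Fin (numIndices (n * N.C1)) × Fin (numIndices (n * N.C2)) := fun w z =>
    (c.relay1 fun k => N.out1 (c.enc w k) (z k), c.relay2 fun k => N.out2 (c.enc w k) (z k)) with hf
  have hm1 : ∀ w, Measurable fun (z : Fin n → ℝ × ℝ × ℝ) k => N.out1 (c.enc w k) (z k) := fun w =>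
    measurable_pi_lambda _ fun k => (N.measurable_out1 _).comp (measurable_pi_apply k)
  have hm2 : ∀ w, Measurable fun (z : Fin n → ℝ × ℝ × ℝ) k => N.out2 (c.enc w k) (z k) := fun w =>
    measurable_pi_lambda _ fun k => (N.measurable_out2 _).comp (measurable_pi_apply k)
  have hfm : ∀ w, Measurable (f w) := fun w =>
    (c.measurable_relay1.comp (hm1 w)).prodMk (c.measurable_relay2.comp (hm2 w))
  have hsum : ∀ (x : Fin n → ℝ) (v : ℝ≥0) {m : ℕ} {g : (Fin n → ℝ) → Fin m}, Measurable g →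
      ∑ a, (Measure.pi fun k => gaussianReal (x k) v).real (g ⁻¹' {a}) ≤ 1 := fun x v m g hg => by
    have := sum_ite_measureReal_preimage (Measure.pi fun k => gaussianReal (x k) v) hg
      (fun _ => True)
    simp only [if_true] at this
    rw [this]
    simp
  -- The rounding error squared is at most `PJ / 4` per coordinate, while the noise variance is at
  -- least `PJ`; the divergence is therefore at most `1 / 8` per coordinate.
  have hquad : ∀ (s : ℝ) (v : ℝ≥0) (w), s ^ 2 ≤ 1 →
      (∑ k, (s * c.enc w k - s * (d * (t w).1 k)) ^ 2) / (2 * ((N.PJ + v : ℝ≥0) : ℝ)) ≤ n / 8 := by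
    intro s v w hs
    have h1 : ∑ k, (s * c.enc w k - s * (d * (t w).1 k)) ^ 2 ≤ ∑ _k : Fin n, d ^ 2 / 4 := by
      refine Finset.sum_le_sum fun k _ => ?_
      have := sq_sub_mul_round_le hd0 (c.enc w k)
      rw [← mul_sub, mul_pow]
      exact (mul_le_of_le_one_left (sq_nonneg _) hs).trans this
    rw [Finset.sum_const, Finset.card_univ, Fintype.card_fin, nsmul_eq_mul, hd2] at h1
    have hvn : (0 : ℝ) ≤ v := v.2
    push_cast
    rw [div_le_iff₀ (by positivity)]
    refine h1.trans ?_
    have : (0 : ℝ) ≤ n * v := by positivity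
    nlinarith
  have key := log_card_le_of_genie
    (fun w m => (N.noiseN n).real (f w ⁻¹' {m})) (fun w m => measureReal_nonneg)
    (fun w => by
      have := sum_ite_measureReal_preimage (N.noiseN n) (hfm w) (fun _ => True)
      simpa using this)
    c.dec t (fun y => ∏ k, (Real.exp (-l * (y.1 k : ℝ) ^ 2) / Z))
    (fun y => Finset.prod_pos fun k _ => by positivity)
    (by
      rw [Finset.sum_coe_sort S fun y => ∏ k, (Real.exp (-l * (y k : ℝ) ^ 2) / Z)]
      exact sum_prod_exp_div_le_one hl0 hZle S)
    (fun w a => (Measure.pi fun k => gaussianReal (N.a * c.enc w k) (N.PJ + N.PN1)).real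
      (c.relay1 ⁻¹' {a}))
    (fun w a => by
      rw [sum_ite_measureReal_preimage _ (hfm w) fun m => m.1 = a, ← N.map_out1_noiseN,
        map_measureReal_apply (hm1 w) (c.measurable_relay1 (measurableSet_singleton a))]
      rfl)
    (fun w b => (Measure.pi fun k => gaussianReal (N.b * c.enc w k) (N.PJ + N.PN2)).real
      (c.relay2 ⁻¹' {b}))
    (fun w b => by
      rw [sum_ite_measureReal_preimage _ (hfm w) fun m => m.2 = b, ← N.map_out2_noiseN,
        map_measureReal_apply (hm2 w) (c.measurable_relay2 (measurableSet_singleton b))]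
      rfl)
    -- The test law for a relay message is the one produced by sending the grid point in place of
    -- the codeword.
    (fun y a => (Measure.pi fun k => gaussianReal (N.a * (d * y.1 k)) (N.PJ + N.PN1)).real
      (c.relay1 ⁻¹' {a}))
    (fun y a => measureReal_nonneg) (fun y => hsum _ _ c.measurable_relay1)
    (fun w a => (sum_mul_log_pi_gaussianReal_le c.measurable_relay1 _ _ hv1).2 a)
    (fun y b => (Measure.pi fun k => gaussianReal (N.b * (d * y.1 k)) (N.PJ + N.PN2)).real
      (c.relay2 ⁻¹' {b}))
    (fun y b => measureReal_nonneg) (fun y => hsum _ _ c.measurable_relay2)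
    (fun w b => (sum_mul_log_pi_gaussianReal_le c.measurable_relay2 _ _ hv2).2 b)
    (D := n / 8)
    (fun w => (sum_mul_log_pi_gaussianReal_le c.measurable_relay1 _ _ hv1).1.trans (hquad _ _ w ha))
    (fun w => (sum_mul_log_pi_gaussianReal_le c.measurable_relay2 _ _ hv2).1.trans (hquad _ _ w hb))
    (ε := ε) (by
      refine le_trans (le_of_eq ?_) hε
      rw [Network.Code.errorProb, Fintype.card_fin]
      congr 1
      refine Finset.sum_congr rfl fun w _ => ?_
      rw [sum_ite_measureReal_preimage _ (hfm w) fun m => c.dec m ≠ w])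
  simp only [Fintype.card_fin] at key
  have hent : -((∑ w, Real.log (∏ k, (Real.exp (-l * ((t w).1 k : ℝ) ^ 2) / Z)))
      / (numIndices (n * R) : ℝ)) ≤ n * (Real.log Z + 1 / 2) := by
    have e : ∀ w, Real.log (∏ k, (Real.exp (-l * ((t w).1 k : ℝ) ^ 2) / Z))
        ≥ -(n * Real.log Z + l * (5 / 4) * (∑ k, c.enc w k ^ 2) / N.PJ + l * (5 / 4) * n) := by
      intro w
      rw [Real.log_prod fun k _ => by positivity]
      have : ∀ k, -(Real.log Z + l * (5 / 4) * c.enc w k ^ 2 / N.PJ + l * (5 / 4)) ≤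
          Real.log (Real.exp (-l * ((t w).1 k : ℝ) ^ 2) / Z) := by
        intro k
        rw [Real.log_div (Real.exp_pos _).ne' hZ0.ne', Real.log_exp]
        have h1 := mul_le_mul_of_nonneg_left (sq_round_le (c.enc w k / d)) hl0.le
        rw [div_pow, hd2] at h1
        have h2 : l * (5 / 4 * (c.enc w k ^ 2 / N.PJ + 1))
            = l * (5 / 4) * c.enc w k ^ 2 / N.PJ + l * (5 / 4) := by ring
        rw [h2] at h1
        simp only [ht, hT]
        linarith
      refine le_trans (le_of_eq ?_) (Finset.sum_le_sum fun k _ => this k)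
      rw [Finset.sum_neg_distrib, Finset.sum_add_distrib, Finset.sum_add_distrib, ← Finset.sum_div,
        ← Finset.mul_sum]
      simp
      ring
    have h1 := Finset.sum_le_sum fun w (_ : w ∈ Finset.univ) => e w
    rw [Finset.sum_neg_distrib, Finset.sum_add_distrib, Finset.sum_add_distrib, ← Finset.sum_div,
        ← Finset.mul_sum, ← Finset.mul_sum, Finset.sum_const, Finset.sum_const, Finset.card_univ, Fintype.card_fin,
        nsmul_eq_mul, nsmul_eq_mul] at h1
    have hpow := c.power
    rw [div_le_iff₀ hW'] at hpow
    have h2 : l * (5 / 4) * (∑ w, ∑ k, c.enc w k ^ 2) / N.PJ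
        ≤ l * (5 / 4) * (n * ρ * numIndices (n * R)) := by
      rw [mul_div_assoc]
      refine mul_le_mul_of_nonneg_left ?_ (by positivity)
      rw [div_le_iff₀ hPJ', hρ]
      refine hpow.trans (le_of_eq ?_)
      field_simp
    have h3 : l * (5 / 4) * (1 + ρ) = 1 / 2 := by
      rw [hl]; field_simp; norm_num
    rw [← neg_div, div_le_iff₀ hW']
    have h4 : l * (5 / 4) * (n * ρ * numIndices (n * R)) + numIndices (n * R) * (l * (5 / 4) * n)
        = n * (1 / 2) * numIndices (n * R) := by
      rw [← h3]; ring
    linarith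
  have hlZ : Real.log Z = Real.log (1 + ρ) / 2 + Real.log (1 + √(5 * Real.pi / 2)) := by
    rw [hZ, Real.log_mul (by positivity) (by positivity), Real.log_sqrt (by positivity)]
  rw [hlZ] at hent
  linarith

end Converse

/-! ### Passage from block codes to achievable rates -/

section Converse

lemma log_one_add_sqrt_le :
    Real.log (1 + √(5 * Real.pi / 2)) + 3 / 4 ≤ Real.log (8 * Real.pi * Real.exp 1) / 2 := by
  have hs : √(5 * Real.pi / 2) ≤ 2.803 := by
    rw [Real.sqrt_le_left (by norm_num)]
    have := Real.pi_lt_d4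
    norm_num at *
    linarith
  have hs0 := Real.sqrt_nonneg (5 * Real.pi / 2)
  set u := 1 + √(5 * Real.pi / 2) with hu
  have hu0 : 0 < u := by positivity
  have he : Real.exp (1 / 2) ≤ 1.65 := by
    have h1 : Real.exp (1 / 2) ^ 2 = Real.exp 1 := by rw [← Real.exp_nat_mul]; norm_num
    have := Real.exp_one_lt_d9
    nlinarith [Real.exp_pos (1 / 2)]
  -- This is the claim doubled and exponentiated, after cancelling a factor `e`.
  have h : u ^ 2 * Real.exp (1 / 2) ≤ 8 * Real.pi := by
    have h1 : u ^ 2 ≤ 14.47 := by nlinarith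
    have h2 := Real.pi_gt_d4
    calc u ^ 2 * Real.exp (1 / 2) ≤ 14.47 * 1.65 := by gcongr
      _ ≤ 8 * Real.pi := by linarith
  have h3 := Real.log_le_log (by positivity) h
  rw [Real.log_mul (by positivity) (by positivity), Real.log_exp, Real.log_pow] at h3
  rw [Real.log_mul (by positivity) (by positivity), Real.log_exp]
  push_cast at h3
  linarith

lemma log_numIndices_le {r : ℝ} (hr : 0 ≤ r) : Real.log (numIndices r) ≤ r * Real.log 2 := by
  have h1 : (1 : ℝ) ≤ 2 ^ r := Real.one_le_rpow (by norm_num) hr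
  have h2 : 0 < numIndices r := Nat.floor_pos.2 h1
  rw [← Real.log_rpow two_pos]
  exact Real.log_le_log (by exact_mod_cast h2) (Nat.floor_le (by positivity))

lemma le_log_numIndices {r : ℝ} (hr : 0 ≤ r) :
    0 < numIndices r ∧ (r - 1) * Real.log 2 ≤ Real.log (numIndices r) := by
  have h1 : (1 : ℝ) ≤ 2 ^ r := Real.one_le_rpow (by norm_num) hr
  have h2 : 0 < numIndices r := Nat.floor_pos.2 h1
  refine ⟨h2, ?_⟩
  have h3 : (1 : ℝ) ≤ numIndices r := by exact_mod_cast h2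
  have h4 : (2 : ℝ) ^ r < numIndices r + 1 := Nat.lt_floor_add_one _
  rw [← Real.log_rpow two_pos, Real.rpow_sub two_pos, Real.rpow_one]
  exact Real.log_le_log (by positivity) (by linarith)

/-- The modulo bound holds for every network with gains at most one and nonzero interference. -/
theorem Network.Achievable.le_moduloBound {N : Network} (hPJ : 0 < N.PJ) (ha : N.a ^ 2 ≤ 1)
    (hb : N.b ^ 2 ≤ 1) (hC1 : 0 ≤ N.C1) (hC2 : 0 ≤ N.C2) {R : ℝ} (h : N.Achievable R) :
    R ≤ N.moduloBound := by
  set M := N.moduloBound with hM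
  have hl2 : 0 < Real.log 2 := Real.log_pos (by norm_num)
  have hPJ' : (0 : ℝ) < N.PJ := by exact_mod_cast hPJ
  have hMl : 2 * M * Real.log 2 = N.C1 * Real.log 2 + N.C2 * Real.log 2
      + Real.log (1 + N.PX / N.PJ) / 2 + Real.log (8 * Real.pi * Real.exp 1) / 2 := by
    rw [hM, Network.moduloBound, Real.logb, Real.logb]
    field_simp
    ring
  have hM0 : 0 ≤ M := by
    have h1 : 0 ≤ Real.log (1 + N.PX / N.PJ) :=
      Real.log_nonneg (le_add_of_nonneg_right (by positivity))
    have h2 : 0 ≤ Real.log (1 + √(5 * Real.pi / 2)) :=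
      Real.log_nonneg (le_add_of_nonneg_right (by positivity))
    have h3 := log_one_add_sqrt_le
    have h4 : 0 ≤ 2 * M * Real.log 2 := by
      rw [hMl]
      have := mul_nonneg hC1 hl2.le
      have := mul_nonneg hC2 hl2.le
      linarith
    nlinarith
  by_contra! hlt
  have hR : 0 < R := hM0.trans_lt hlt
  -- With this `ε`, `(1 - ε) R` is the midpoint of `R` and `M`. The linear gain `n (R - M) / 2` must
  -- then stay below a constant, which `n > 4 / (R - M)` forbids.
  set ε := (R - M) / (2 * R) with hε
  have hε0 : 0 < ε := div_pos (by linarith) (by linarith)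
  have hε1 : ε * R = (R - M) / 2 := by rw [hε]; field_simp
  have hε2 : ε ≤ 1 := by rw [hε, div_le_one (by linarith)]; linarith
  obtain ⟨n₀, hn₀⟩ := h ε hε0
  obtain ⟨n₁, hn₁⟩ := exists_nat_gt (4 / (R - M))
  obtain ⟨n, hnl, hnr⟩ : ∃ n, n₀ ≤ n ∧ n₁ ≤ n := ⟨_, le_max_left _ _, le_max_right _ _⟩
  obtain ⟨c, hc⟩ := hn₀ n hnl
  have hn : 4 / (R - M) < n := hn₁.trans_le (by exact_mod_cast hnr)
  have hn0 : (0 : ℝ) ≤ n := Nat.cast_nonneg n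
  rw [div_lt_iff₀ (by linarith)] at hn
  obtain ⟨hW, hWl⟩ := le_log_numIndices (mul_nonneg hn0 hR.le)
  have key := log_le_of_errorProb_le hPJ ha hb c hW hc
  have k1 := log_numIndices_le (mul_nonneg hn0 hC1)
  have k2 := log_numIndices_le (mul_nonneg hn0 hC2)
  have k3 := mul_le_mul_of_nonneg_left log_one_add_sqrt_le hn0
  have k4 := mul_le_mul_of_nonneg_left hWl (show 0 ≤ 2 * (1 - ε) by linarith)
  have k5 : 2 * (1 - ε) * ((n * R - 1) * Real.log 2) ≤ n * (2 * M * Real.log 2) + 2 * Real.log 2 := by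
    rw [hMl]; linarith
  have k6 : (1 - ε) * (n * R - 1) ≤ n * M + 1 := by
    refine le_of_mul_le_mul_right ?_ (show 0 < 2 * Real.log 2 by linarith)
    linarith
  have k7 : (1 - ε) * (n * R - 1) = n * (R - (R - M) / 2) - 1 + ε := by rw [← hε1]; ring
  nlinarith

end Converse

/-! ### Lower bounds for mutual information -/

section MutualInfo

open InformationTheory

/-- A variational bound with the test function `log (1 / b)` on `E`: an event likely under `ρ` and
rare under `π` forces a large divergence. -/
lemma mul_measure_le_klDiv_add_one {α : Type*} [MeasurableSpace α] (ρ π : Measure α)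
    [IsFiniteMeasure ρ] [IsFiniteMeasure π] {E : Set α} {b : ℝ} (hb : 0 < b)
    (hπ : π E ≤ ENNReal.ofReal b) :
    ENNReal.ofReal (Real.log (1 / b)) * ρ E ≤ klDiv ρ π + 1 := by
  rw [klDiv_eq_lintegral_klFun]
  split_ifs with hac
  swap
  · simp
  set c := Real.log (1 / b) with hc
  have hec : Real.exp c = 1 / b := Real.exp_log (by positivity)
  -- Fenchel–Young: the conjugate of `klFun` at `c` is `exp c - 1`, and `exp c = 1 / b`.
  have young : ∀ r : ℝ, 0 ≤ r → c * r ≤ klFun r + 1 / b := by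
    intro r hr
    rw [klFun_apply, ← hec]
    rcases hr.eq_or_lt with h0 | h0
    · rw [← h0]; simp; positivity
    · have h1 := Real.add_one_le_exp (c - Real.log r)
      rw [Real.exp_sub, Real.exp_log h0, le_div_iff₀ h0] at h1
      nlinarith
  have h1 : ENNReal.ofReal c * ρ E = ∫⁻ x in E, ENNReal.ofReal c * ρ.rnDeriv π x ∂π := by
    rw [lintegral_const_mul _ (Measure.measurable_rnDeriv _ _), Measure.setLIntegral_rnDeriv hac]
  rw [h1]
  calc ∫⁻ x in E, ENNReal.ofReal c * ρ.rnDeriv π x ∂π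
      ≤ ∫⁻ x in E, (ENNReal.ofReal (klFun (ρ.rnDeriv π x).toReal) + ENNReal.ofReal (1 / b)) ∂π := by
        refine lintegral_mono_ae (ae_restrict_of_ae ?_)
        filter_upwards [Measure.rnDeriv_ne_top ρ π] with x hx
        rw [← ENNReal.ofReal_toReal hx, ENNReal.toReal_ofReal ENNReal.toReal_nonneg,
          ← ENNReal.ofReal_mul' ENNReal.toReal_nonneg,
          ← ENNReal.ofReal_add (klFun_nonneg ENNReal.toReal_nonneg) (by positivity)]
        exact ENNReal.ofReal_le_ofReal (young _ ENNReal.toReal_nonneg)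
    _ = ∫⁻ x in E, ENNReal.ofReal (klFun (ρ.rnDeriv π x).toReal) ∂π
          + ENNReal.ofReal (1 / b) * π E := by
        rw [lintegral_add_right _ measurable_const, setLIntegral_const]
    _ ≤ _ := by
        refine add_le_add (setLIntegral_le_lintegral _ _) ?_
        calc ENNReal.ofReal (1 / b) * π E ≤ ENNReal.ofReal (1 / b) * ENNReal.ofReal b := by gcongr
          _ = 1 := by
            rw [← ENNReal.ofReal_mul (by positivity), one_div_mul_cancel hb.ne', ENNReal.ofReal_one]

/-- If the output determines the input up to an independent error `h`, and the input is spread out,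
then the mutual information is large. -/
lemma ofReal_le_mutualInfo {β γ : Type*} [MeasurableSpace β] [MeasurableSpace γ]
    (μ : Measure ℝ) [IsProbabilityMeasure μ] (ν : Measure γ) [IsProbabilityMeasure ν]
    {F : ℝ → γ → β} (hF : Measurable fun p : ℝ × γ => F p.1 p.2) {g : β → ℝ} (hg : Measurable g)
    {h : γ → ℝ} (hgF : ∀ x z, g (F x z) = x + h z) {r s δ : ℝ} (hr : 0 < r)
    (hs : 0 < s) (hδ : δ ≤ 1)
    (hμ : ∀ y, μ (Set.Icc (y - r) (y + r)) ≤ ENNReal.ofReal (r / s))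
    (hν : ENNReal.ofReal (1 - δ) ≤ ν {z | |h z| ≤ r}) :
    ENNReal.ofReal ((Real.log (s / r) * (1 - δ) - 1) / Real.log 2)
      ≤ mutualInfo ((μ.prod ν).map fun p => (p.1, F p.1 p.2)) := by
  have hm : Measurable fun p : ℝ × γ => (p.1, F p.1 p.2) := measurable_fst.prodMk hF
  set ρ := (μ.prod ν).map fun p => (p.1, F p.1 p.2) with hρ
  have hρp : IsProbabilityMeasure ρ := Measure.isProbabilityMeasure_map hm.aemeasurable
  have hfst : ρ.fst = μ := by
    rw [Measure.fst, hρ, Measure.map_map measurable_fst hm]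
    change (μ.prod ν).map Prod.fst = μ
    rw [Measure.map_fst_prod, measure_univ, one_smul]
  set E : Set (ℝ × β) := {q | |g q.2 - q.1| ≤ r} with hE
  have hEm : MeasurableSet E := measurableSet_le
    (by fun_prop : Measurable fun q : ℝ × β => |g q.2 - q.1|) measurable_const
  have hρE : ρ E = ν {z | |h z| ≤ r} := by
    rw [hρ, Measure.map_apply hm hEm]
    have : (fun p : ℝ × γ => (p.1, F p.1 p.2)) ⁻¹' E = Set.univ ×ˢ {z | |h z| ≤ r} := by
      ext p
      simp [hE, hgF]
    rw [this, Measure.prod_prod, measure_univ, one_mul]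
  have hπE : (ρ.fst.prod ρ.snd) E ≤ ENNReal.ofReal (r / s) := by
    -- Under the product law the output is independent of the input, so each slice of `E` lies in an
    -- interval of radius `r` about `g y`.
    rw [hfst, Measure.prod_apply_symm hEm]
    calc ∫⁻ y, μ ((fun x => (x, y)) ⁻¹' E) ∂ρ.snd ≤ ∫⁻ _y, ENNReal.ofReal (r / s) ∂ρ.snd := by
          refine lintegral_mono fun y => (measure_mono fun x hx => ?_).trans (hμ (g y))
          have hx' := abs_le.1 (show |g y - x| ≤ r from hx)
          exact ⟨by linarith, by linarith⟩
      _ = _ := by simp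
  have key := mul_measure_le_klDiv_add_one ρ (ρ.fst.prod ρ.snd) (div_pos hr hs) hπE
  rw [hρE, one_div_div] at key
  have hl2 : 0 < Real.log 2 := Real.log_pos (by norm_num)
  rw [mutualInfo, ENNReal.ofReal_div_of_pos hl2]
  refine ENNReal.div_le_div_right ?_ _
  rw [ENNReal.ofReal_sub _ zero_le_one, ENNReal.ofReal_one, tsub_le_iff_right,
    ENNReal.ofReal_mul' (by linarith)]
  exact le_trans (by gcongr) key

lemma gaussianReal_lt_abs_le (v : ℝ≥0) {r : ℝ} (hr : 0 < r) :
    gaussianReal 0 v {x | r < |x|} ≤ ENNReal.ofReal (v / r ^ 2) := by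
  have h := meas_ge_le_variance_div_sq (memLp_id_gaussianReal (μ := 0) (v := v) 2) hr
  rw [variance_id_gaussianReal] at h
  refine (measure_mono fun x hx => ?_).trans h
  simp only [Set.mem_ofPred_eq, id, integral_id_gaussianReal, sub_zero]
  exact le_of_lt hx

/-- The uniform law on `[-s, s]`. -/
def uniformLaw (s : ℝ) : Measure ℝ :=
  ENNReal.ofReal (1 / (2 * s)) • volume.restrict (Set.Icc (-s) s)

lemma isProbabilityMeasure_uniformLaw {s : ℝ} (hs : 0 < s) :
    IsProbabilityMeasure (uniformLaw s) := by
  constructor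
  rw [uniformLaw, Measure.smul_apply, Measure.restrict_apply_univ, Real.volume_Icc, smul_eq_mul,
    ← ENNReal.ofReal_mul (by positivity)]
  rw [show 1 / (2 * s) * (s - -s) = 1 by field_simp; ring, ENNReal.ofReal_one]

lemma uniformLaw_Icc_le {s r : ℝ} (hs : 0 < s) (y : ℝ) :
    uniformLaw s (Set.Icc (y - r) (y + r)) ≤ ENNReal.ofReal (r / s) := by
  rw [uniformLaw, Measure.smul_apply, smul_eq_mul]
  calc _ ≤ ENNReal.ofReal (1 / (2 * s)) * volume (Set.Icc (y - r) (y + r)) := by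
        gcongr
        exact Measure.restrict_le_self
    _ = _ := by
        rw [Real.volume_Icc, ← ENNReal.ofReal_mul (by positivity)]
        congr 1
        field_simp
        ring

lemma lintegral_sq_uniformLaw_le {s : ℝ} (hs : 0 < s) :
    ∫⁻ x, ENNReal.ofReal (x ^ 2) ∂uniformLaw s ≤ ENNReal.ofReal (s ^ 2) := by
  have := isProbabilityMeasure_uniformLaw hs
  have hae : ∀ᵐ x ∂uniformLaw s, x ∈ Set.Icc (-s) s :=
    Measure.ae_smul_measure (ae_restrict_mem measurableSet_Icc) _
  calc _ ≤ ∫⁻ _x, ENNReal.ofReal (s ^ 2) ∂uniformLaw s := by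
        refine lintegral_mono_ae ?_
        filter_upwards [hae] with x hx
        exact ENNReal.ofReal_le_ofReal (sq_le_sq' hx.1 hx.2)
    _ = _ := by simp

end MutualInfo

/-! ### Bounds on the cut-set bound -/

section CutSet

lemma ofReal_one_sub_le_measure {Ω : Type*} [MeasurableSpace Ω] (μ : Measure Ω)
    [IsProbabilityMeasure μ] {S : Set Ω} (hS : MeasurableSet S) {x : ℝ} (hx : 0 ≤ x)
    (h : μ Sᶜ ≤ ENNReal.ofReal x) : ENNReal.ofReal (1 - x) ≤ μ S := by
  rw [ENNReal.ofReal_sub _ hx, ENNReal.ofReal_one, tsub_le_iff_right, ← prob_add_prob_compl (μ := μ) hS]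
  gcongr

lemma gaussianReal_abs_le {Ω : Type*} [MeasurableSpace Ω] (μ : Measure Ω)
    [IsProbabilityMeasure μ] {h : Ω → ℝ} (hh : Measurable h) {v : ℝ≥0}
    (hl : μ.map h = gaussianReal 0 v) {r : ℝ} (hr : 0 < r) :
    μ {z | |h z| ≤ r}ᶜ ≤ ENNReal.ofReal (v / r ^ 2) := by
  refine le_trans (le_of_eq ?_) (gaussianReal_lt_abs_le v hr)
  rw [← hl, Measure.map_apply hh (measurableSet_lt measurable_const (by fun_prop))]
  congr 1
  ext z
  simp

lemma map_noise1 (N : Network) : N.noise.map (fun z => z.2.1) = gaussianReal 0 N.PN1 := by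
  change N.noise.map (Prod.fst ∘ Prod.snd) = _
  rw [← Measure.map_map measurable_fst measurable_snd, Network.noise, Measure.map_snd_prod,
    measure_univ, one_smul, Measure.map_fst_prod, measure_univ, one_smul]

lemma map_noise2 (N : Network) : N.noise.map (fun z => z.2.2) = gaussianReal 0 N.PN2 := by
  change N.noise.map (Prod.snd ∘ Prod.snd) = _
  rw [← Measure.map_map measurable_snd measurable_snd, Network.noise, Measure.map_snd_prod,
    measure_univ, one_smul, Measure.map_snd_prod, measure_univ, one_smul]

variable {PX PJ : ℝ≥0} {C1 C2 : ℝ} {s r δ : ℝ}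

/-- The output itself estimates the input with error `J + N₁` of variance `PJ + 1`; Chebyshev makes
`δ` the failure probability. -/
lemma le_info1_uniformLaw (hs : 0 < s) (hr : 0 < r) (hδ1 : δ ≤ 1)
    (hδ : ((PJ + 1 : ℝ≥0) : ℝ) / r ^ 2 ≤ δ) :
    ENNReal.ofReal ((Real.log (s / r) * (1 - δ) - 1) / Real.log 2)
      ≤ (caseC PX PJ C1 C2).info1 (uniformLaw s) := by
  have := isProbabilityMeasure_uniformLaw hs
  set N := caseC PX PJ C1 C2 with hN
  have hm : Measurable (N.out1 0) := N.measurable_out1 0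
  have hl := N.map_out1_noise 0
  rw [mul_zero] at hl
  refine ofReal_le_mutualInfo (uniformLaw s) N.noise (F := N.out1)
    (by unfold Network.out1; fun_prop) measurable_id (h := N.out1 0)
    (fun x z => by simp [Network.out1, hN, caseC, add_assoc]) hr hs hδ1
    (fun y => uniformLaw_Icc_le hs y) ?_
  refine (ENNReal.ofReal_le_ofReal (sub_le_sub_left hδ 1)).trans
    (ofReal_one_sub_le_measure _ (measurableSet_le (by fun_prop) measurable_const)
    (by positivity) (gaussianReal_abs_le N.noise hm hl hr))

lemma le_info2_uniformLaw (hs : 0 < s) (hr : 0 < r) (hδ1 : δ ≤ 1)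
    (hδ : ((PJ + 1 : ℝ≥0) : ℝ) / r ^ 2 ≤ δ) :
    ENNReal.ofReal ((Real.log (s / r) * (1 - δ) - 1) / Real.log 2)
      ≤ (caseC PX PJ C1 C2).info2 (uniformLaw s) := by
  have := isProbabilityMeasure_uniformLaw hs
  set N := caseC PX PJ C1 C2 with hN
  have hm : Measurable (N.out2 0) := N.measurable_out2 0
  have hl := N.map_out2_noise 0
  rw [mul_zero] at hl
  refine ofReal_le_mutualInfo (uniformLaw s) N.noise (F := N.out2)
    (by unfold Network.out2; fun_prop) measurable_neg (h := fun z => -N.out2 0 z)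
    (fun x z => by simp [Network.out2, hN, caseC]; ring) hr hs hδ1
    (fun y => uniformLaw_Icc_le hs y) ?_
  simp only [abs_neg]
  refine (ENNReal.ofReal_le_ofReal (sub_le_sub_left hδ 1)).trans
    (ofReal_one_sub_le_measure _ (measurableSet_le (by fun_prop) measurable_const)
    (by positivity) (gaussianReal_abs_le N.noise hm hl hr))

/-- The opposite signs of the gains make `(Y₁ - Y₂) / 2 = X + (N₁ - N₂) / 2` free of interference,
so no `PJ` enters the condition on `r`. -/
lemma le_info12_uniformLaw (hs : 0 < s) (hr : 0 < r) (hδ1 : δ ≤ 1) (hδ : 2 / r ^ 2 ≤ δ) :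
    ENNReal.ofReal ((Real.log (s / r) * (1 - δ) - 1) / Real.log 2)
      ≤ (caseC PX PJ C1 C2).info12 (uniformLaw s) := by
  have := isProbabilityMeasure_uniformLaw hs
  set N := caseC PX PJ C1 C2 with hN
  refine ofReal_le_mutualInfo (uniformLaw s) N.noise
    (F := fun x z => (N.out1 x z, N.out2 x z))
    (by unfold Network.out1 Network.out2; fun_prop) (g := fun y => (y.1 - y.2) / 2) (by fun_prop)
    (h := fun z => (z.2.1 - z.2.2) / 2)
    (fun x z => by simp [Network.out1, Network.out2, hN, caseC]; ring) hr hs hδ1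
    (fun y => uniformLaw_Icc_le hs y) ?_
  refine (ENNReal.ofReal_le_ofReal (by linarith)).trans (ofReal_one_sub_le_measure _
    (measurableSet_le (by fun_prop) measurable_const) (by positivity) (x := 2 / r ^ 2) ?_)
  have h1 := gaussianReal_abs_le N.noise (by fun_prop) (map_noise1 N) hr
  have h2 := gaussianReal_abs_le N.noise (by fun_prop) (map_noise2 N) hr
  have e : (2 : ℝ) / r ^ 2 = (N.PN1 : ℝ) / r ^ 2 + (N.PN2 : ℝ) / r ^ 2 := by
    simp [hN, caseC]; ring
  rw [e, ENNReal.ofReal_add (by positivity) (by positivity)]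
  refine le_trans (le_trans (measure_mono ?_) (measure_union_le _ _)) (add_le_add h1 h2)
  intro z hz
  by_contra hc
  simp only [Set.mem_union, Set.mem_compl_iff, Set.mem_ofPred_eq, not_or, not_not] at hc hz
  refine hz (abs_le.2 ?_)
  have a1 := abs_le.1 hc.1
  have a2 := abs_le.1 hc.2
  constructor <;> linarith

lemma le_cutSetBound_looseExample (hδ0 : 0 < δ) (hδ1 : δ < 1) {P : ℝ≥0} (hP : 1 < P) :
    ENNReal.ofReal ((1 - δ) / 2 * Real.logb 2 P - (Real.log (4 / δ) + 1) / Real.log 2)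
      ≤ (looseExample P).cutSetBound := by
  have hl2 : 0 < Real.log 2 := Real.log_pos (by norm_num)
  have hP1 : (1 : ℝ) < P := by exact_mod_cast hP
  have hlP : 0 < Real.log P := Real.log_pos hP1
  set ℓ := Real.logb 2 P with hℓ
  have hℓ0 : 0 < ℓ := div_pos hlP hl2
  have hℓl : Real.log P = ℓ * Real.log 2 := by rw [hℓ, Real.logb]; field_simp
  have hs1 : 1 < √(P : ℝ) := by rw [Real.lt_sqrt zero_le_one]; simpa using hP1
  set s := √(P : ℝ) with hs
  have hs0 : 0 < s := by linarith
  have hs2 : s ^ 2 = P := Real.sq_sqrt (by linarith)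
  have hls : Real.log s = Real.log P / 2 := Real.log_sqrt (by linarith)
  set L := 2 / δ with hL
  have hL0 : 0 < L := by positivity
  have hL2 : 2 / L ^ 2 ≤ δ := by
    rw [hL, div_pow, div_div_eq_mul_div]
    nlinarith
  have hLL : Real.log (4 / δ) = Real.log 2 + Real.log L := by
    rw [← Real.log_mul two_ne_zero hL0.ne']; congr 1; rw [hL]; ring
  have hL1 : 0 ≤ Real.log L := Real.log_nonneg (by rw [hL, le_div_iff₀ hδ0]; linarith)
  set K := (Real.log (4 / δ) + 1) / Real.log 2 with hK
  have hK0 : 0 ≤ K := by rw [hK, hLL]; positivity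
  -- With `PJ = s`, the radius is `L` standard deviations of `J + Nᵢ` and grows like `P ^ (1 / 4)`.
  -- For the joint output the fixed radius `L` is enough.
  set r := L * √(s + 1) with hr
  have hr0 : 0 < r := by positivity
  have hJ : ((NNReal.sqrt P : ℝ≥0) : ℝ) = s := by simp [hs]
  have hrδ : ((NNReal.sqrt P + 1 : ℝ≥0) : ℝ) / r ^ 2 ≤ δ := by
    rw [NNReal.coe_add, hJ, NNReal.coe_one, hr, mul_pow, Real.sq_sqrt (by linarith)]
    refine le_trans (le_of_eq ?_) (le_trans (show 1 / L ^ 2 ≤ 2 / L ^ 2 by gcongr; norm_num) hL2)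
    field_simp
  have hlr : Real.log r ≤ Real.log L + Real.log 2 + Real.log P / 4 := by
    have h1 : Real.log (s + 1) ≤ Real.log (2 ^ 2 * s) := Real.log_le_log (by linarith) (by linarith)
    rw [Real.log_mul (by norm_num) hs0.ne', Real.log_pow, hls] at h1
    push_cast at h1
    rw [hr, Real.log_mul hL0.ne' (by positivity), Real.log_sqrt (by linarith)]
    linarith
  have b1 : (1 - δ) / 4 * ℓ - K ≤ (Real.log (s / r) * (1 - δ) - 1) / Real.log 2 := by
    rw [le_div_iff₀ hl2, sub_mul, hK, div_mul_cancel₀ _ hl2.ne', mul_assoc, ← hℓl,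
      Real.log_div hs0.ne' hr0.ne', hls, hLL]
    nlinarith
  have b2 : (1 - δ) / 2 * ℓ - K ≤ (Real.log (s / L) * (1 - δ) - 1) / Real.log 2 := by
    rw [le_div_iff₀ hl2, sub_mul, hK, div_mul_cancel₀ _ hl2.ne', mul_assoc, ← hℓl,
      Real.log_div hs0.ne' hL0.ne', hls, hLL]
    nlinarith
  have hδℓ : 0 ≤ δ * ℓ := by positivity
  have hC : ∀ I : ℝ≥0∞, ENNReal.ofReal ((Real.log (s / r) * (1 - δ) - 1) / Real.log 2) ≤ I →
      ENNReal.ofReal ((1 - δ) / 2 * ℓ - K) ≤ ENNReal.ofReal (ℓ / 4) + I := fun I hI =>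
    calc _ ≤ ENNReal.ofReal (ℓ / 4 + (Real.log (s / r) * (1 - δ) - 1) / Real.log 2) :=
          ENNReal.ofReal_le_ofReal (by linarith)
      _ ≤ _ := ENNReal.ofReal_add_le
      _ ≤ _ := by gcongr
  refine le_iSup_of_le (uniformLaw s) (le_iSup_of_le (isProbabilityMeasure_uniformLaw hs0)
    (le_iSup_of_le ?_ (le_min (le_min ?_ ?_) (le_min ?_ ?_))))
  · refine (lintegral_sq_uniformLaw_le hs0).trans (le_of_eq ?_)
    rw [hs2, ENNReal.ofReal_coe_nnreal]
    rfl
  · change _ ≤ ENNReal.ofReal (ℓ / 4) + ENNReal.ofReal (ℓ / 4)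
    rw [← ENNReal.ofReal_add (by positivity) (by positivity)]
    exact ENNReal.ofReal_le_ofReal (by linarith)
  · exact hC _ (le_info2_uniformLaw hs0 hr0 hδ1.le hrδ)
  · exact hC _ (le_info1_uniformLaw hs0 hr0 hδ1.le hrδ)
  · exact (ENNReal.ofReal_le_ofReal b2).trans (le_info12_uniformLaw hs0 hL0 hδ1.le hL2)

lemma cutSetBound_looseExample_le {P : ℝ≥0} (hP : 1 < P) :
    (looseExample P).cutSetBound ≤ ENNReal.ofReal (Real.logb 2 P / 2) := by
  have hP1 : (1 : ℝ) < P := by exact_mod_cast hP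
  have hℓ0 : 0 < Real.logb 2 P := Real.logb_pos (by norm_num) hP1
  refine iSup_le fun μ => iSup_le fun _ => iSup_le fun _ =>
    (min_le_left _ _).trans ((min_le_left _ _).trans ?_)
  change ENNReal.ofReal (Real.logb 2 P / 4) + ENNReal.ofReal (Real.logb 2 P / 4) ≤ _
  rw [← ENNReal.ofReal_add (by positivity) (by positivity)]
  exact ENNReal.ofReal_le_ofReal (by linarith)

end CutSet

/-! ### Limits as the power grows -/

section Asymptotics

lemma tendsto_logb_atTop : Tendsto (fun P : ℝ≥0 => Real.logb 2 P) atTop atTop :=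
  (Real.tendsto_logb_atTop (by norm_num)).comp (NNReal.tendsto_coe_atTop.2 tendsto_id)

lemma tendsto_cutSetBound_looseExample : Tendsto (fun P : ℝ≥0 =>
    (looseExample P).cutSetBound.toReal / Real.logb 2 P) atTop (𝓝 (1 / 2)) := by
  rw [Metric.tendsto_nhds]
  intro ε hε
  obtain ⟨δ, hδ0, hδ1, hδε⟩ : ∃ δ : ℝ, 0 < δ ∧ δ < 1 ∧ δ ≤ ε :=
    ⟨min ε (1 / 2), by positivity, by linarith [min_le_right ε (1 / 2)], min_le_left _ _⟩
  set K := (Real.log (4 / δ) + 1) / Real.log 2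
  -- Beyond this threshold the additive loss `K` is below `ε / 2` times the logarithm; the factor `1
  -- - δ` costs at most another `ε / 2`.
  filter_upwards [tendsto_logb_atTop.eventually_gt_atTop (2 * K / ε), eventually_gt_atTop 1]
    with P hPK hP
  have hP1 : (1 : ℝ) < P := by exact_mod_cast hP
  have hℓ0 : 0 < Real.logb 2 P := Real.logb_pos (by norm_num) hP1
  have hub := cutSetBound_looseExample_le hP
  have hlb := le_cutSetBound_looseExample hδ0 hδ1 hP
  have hfin : (looseExample P).cutSetBound ≠ ⊤ := ne_top_of_le_ne_top ENNReal.ofReal_ne_top hub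
  have h1 := ENNReal.toReal_le_of_le_ofReal (by positivity) hub
  have h2 := (ENNReal.ofReal_le_iff_le_toReal hfin).1 hlb
  rw [div_lt_iff₀ hε] at hPK
  rw [Real.dist_eq, abs_lt]
  constructor
  · rw [lt_sub_iff_add_lt, lt_div_iff₀ hℓ0]
    nlinarith
  · rw [sub_lt_iff_lt_add, div_lt_iff₀ hℓ0]
    nlinarith

lemma tendsto_moduloBound_looseExample : Tendsto (fun P : ℝ≥0 =>
    (looseExample P).moduloBound / Real.logb 2 P) atTop (𝓝 (3 / 8)) := by
  set c := Real.logb 2 (8 * Real.pi * Real.exp 1) / 4 with hc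
  have hlow : Tendsto (fun P : ℝ≥0 => 3 / 8 + c / Real.logb 2 P) atTop (𝓝 (3 / 8)) := by
    simpa using (tendsto_const_nhds (x := (3 / 8 : ℝ))).add
      (tendsto_logb_atTop.const_div_atTop c)
  have hup : Tendsto (fun P : ℝ≥0 => 3 / 8 + (c + 1 / 4) / Real.logb 2 P) atTop (𝓝 (3 / 8)) := by
    simpa using (tendsto_const_nhds (x := (3 / 8 : ℝ))).add
      (tendsto_logb_atTop.const_div_atTop (c + 1 / 4))
  -- Here `PX / PJ = √P`, and `√P ≤ 1 + √P ≤ 2 √P`; the factor `2` accounts for the slack `1 / 4`.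
  have key : ∀ P : ℝ≥0, 1 < P → 0 < Real.logb 2 P ∧
      3 / 8 * Real.logb 2 P + c ≤ (looseExample P).moduloBound ∧
      (looseExample P).moduloBound ≤ 3 / 8 * Real.logb 2 P + (c + 1 / 4) := by
    intro P hP
    have hP1 : (1 : ℝ) < P := by exact_mod_cast hP
    have hs1 : 1 < √(P : ℝ) := by rw [Real.lt_sqrt zero_le_one]; simpa using hP1
    have hs0 : 0 < √(P : ℝ) := by linarith
    have e : (looseExample P).moduloBound = (Real.logb 2 P / 4 + Real.logb 2 P / 4
        + Real.logb 2 (1 + √(P : ℝ)) / 2) / 2 + c := by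
      have : (P : ℝ) / √(P : ℝ) = √(P : ℝ) := Real.div_sqrt
      simp [Network.moduloBound, looseExample, caseC, this, hc]
    have hls : Real.logb 2 √(P : ℝ) = Real.logb 2 P / 2 := by
      rw [Real.logb, Real.logb, Real.log_sqrt (by linarith)]; ring
    have l1 : Real.logb 2 √(P : ℝ) ≤ Real.logb 2 (1 + √(P : ℝ)) :=
      Real.logb_le_logb_of_le (by norm_num) hs0 (by linarith)
    have l2 : Real.logb 2 (1 + √(P : ℝ)) ≤ Real.logb 2 (2 * √(P : ℝ)) :=
      Real.logb_le_logb_of_le (by norm_num) (by linarith) (by linarith)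
    rw [Real.logb_mul two_ne_zero hs0.ne', Real.logb_self_eq_one (by norm_num)] at l2
    rw [e]
    exact ⟨Real.logb_pos (by norm_num) hP1, by linarith, by linarith⟩
  refine tendsto_of_tendsto_of_tendsto_of_le_of_le' hlow hup ?_ ?_
  · filter_upwards [eventually_gt_atTop 1] with P hP
    obtain ⟨h0, h1, -⟩ := key P hP
    rw [le_div_iff₀ h0, add_mul, div_mul_cancel₀ _ h0.ne']
    exact h1
  · filter_upwards [eventually_gt_atTop 1] with P hP
    obtain ⟨h0, -, h1⟩ := key P hP
    rw [div_le_iff₀ h0, add_mul, div_mul_cancel₀ _ h0.ne']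
    exact h1

lemma achievable_le_moduloBound_looseExample {P : ℝ≥0} (hP : 1 < P) {R : ℝ}
    (h : (looseExample P).Achievable R) : R ≤ (looseExample P).moduloBound := by
  have hP1 : (1 : ℝ) < P := by exact_mod_cast hP
  have hℓ0 : 0 ≤ Real.logb 2 P / 4 := by
    have := Real.logb_pos (b := 2) (by norm_num) hP1
    positivity
  refine h.le_moduloBound ?_ ?_ ?_ hℓ0 hℓ0
  · exact NNReal.sqrt_pos.2 (zero_lt_one.trans hP)
  · simp [looseExample, caseC]
  · simp [looseExample, caseC]

end Asymptotics

end RelayChannel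
end

theorem mainTheorem7 :
    (∀ P : ℝ≥0, 1 < P → (RelayChannel.looseExample P).cutSetBound ≠ ⊤) ∧
    Tendsto (fun P : ℝ≥0 =>
        (RelayChannel.looseExample P).cutSetBound.toReal / Real.logb 2 P) atTop (𝓝 (1 / 2)) ∧
    (∀ P : ℝ≥0, 1 < P → ∀ R : ℝ, (RelayChannel.looseExample P).Achievable R →
        R ≤ (RelayChannel.looseExample P).moduloBound) ∧
    Tendsto (fun P : ℝ≥0 =>
        (RelayChannel.looseExample P).moduloBound / Real.logb 2 P) atTop (𝓝 (3 / 8)) ∧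
    (∃ ε : ℝ, 0 < ε ∧ ∀ᶠ P : ℝ≥0 in atTop,
        (RelayChannel.looseExample P).moduloBound + ε * Real.logb 2 P
            ≤ (RelayChannel.looseExample P).cutSetBound.toReal ∧
        ∀ R : ℝ, (RelayChannel.looseExample P).Achievable R →
          R + ε * Real.logb 2 P ≤ (RelayChannel.looseExample P).cutSetBound.toReal) := by
  refine ⟨fun P hP => ne_top_of_le_ne_top ENNReal.ofReal_ne_top
      (RelayChannel.cutSetBound_looseExample_le hP),
    RelayChannel.tendsto_cutSetBound_looseExample,
    fun P hP R hR => RelayChannel.achievable_le_moduloBound_looseExample hP hR,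
    -- The gap `1 / 16` separates the thresholds `13 / 32` and `15 / 32` between the limits `3 / 8`
    -- and `1 / 2`.
    RelayChannel.tendsto_moduloBound_looseExample, 1 / 16, by norm_num, ?_⟩
  filter_upwards [eventually_gt_atTop 1,
    RelayChannel.tendsto_cutSetBound_looseExample.eventually_const_lt
      (show (15 / 32 : ℝ) < 1 / 2 by norm_num),
    RelayChannel.tendsto_moduloBound_looseExample.eventually_lt_const
      (show (3 / 8 : ℝ) < 13 / 32 by norm_num)] with P hP h1 h2
  have hP1 : (1 : ℝ) < P := by exact_mod_cast hP
  have hℓ0 : 0 < Real.logb 2 P := Real.logb_pos (by norm_num) hP1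
  rw [lt_div_iff₀ hℓ0] at h1
  rw [div_lt_iff₀ hℓ0] at h2
  refine ⟨by linarith, fun R hR => ?_⟩
  have := RelayChannel.achievable_le_moduloBound_looseExample hP hR
  linarith
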